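/- Let $n\ge 0$, $h\ge 1$, and let $u_{s,I}$ stand for $\partial^{s+|I|}u/\partial t^s\partial x_1^{i_1}\cdots\partial x_n^{i_n}$. Consider a scalar equation $$\frac{\partial^h u}{\partial t^h}=F$$ for $u=u(t,x_1,\dots,x_n)$, where $F$ is a smooth function of $t$, $x_j$, finitely many space derivatives $u_{0,I}$ (including $u$), and the pure time derivatives $u_{s,0}$, $s<h$. Let $U$ be the domain of $F$, an open set (for example, everything) in the space with coordinates $t,\ x_j,\ u_{s,I}$ ($0\le s<h$, $I\in\mathbb Z_{\ge0}^n$). All functions below are smooth functions on $U$ of finitely many of these coordinates. Let $D_{x_i}=\partial_{x_i}+\sum_{s,I}u_{s,I+1_i}\partial_{u_{s,I}}$ and $$D_t=\partial_t+\sum_{I,\,s<h-1}u_{s+1,I}\,\partial_{u_{s,I}}+\sum_I D_x^I(F)\,\partial_{u_{h-1,I}}$$ be the total derivatives restricted to the equation. The order $\mathrm o(f)$ of a function $f$ is the largest $k$ such that $\partial f/\partial u_{s,I}\not\equiv 0$ for some $s<h$ and some $I$ with $|I|=k$, and $\mathrm o(f)=-1$ if there is none. A conserved current is a tuple $J=(J_0,\dots,J_n)$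 with $D_tJ_0+\sum_i D_{x_i}J_i=0$. Writing $D_0=D_t$ and $D_i=D_{x_i}$, a current is trivial if $J_k=\sum_{l<k}D_l\mathcal L_{lk}-\sum_{k<l}D_l\mathcal L_{kl}$ for some functions $\mathcal L_{kl}$, $k<l$. A conservation law is an equivalence class of conserved currents modulo trivial ones, and its order is the order of its characteristic $$\chi=\sum_I(-1)^{|I|}D_x^I\Bigl(\frac{\partial J_0}{\partial u_{h-1,I}}\Bigr).$$ Put $N=\mathrm o(F)$ and assume that $N>0$ and that the symbol $A=\sum_{|I|=N}\frac{\partial F}{\partial u_{0,I}}q^I$ (a polynomial in $q_1,\dots,q_n$ whose coefficients are functions on $U$) does not vanish identically on any nonempty open subset of $U$; this is automatic if $F$ is analytic and $U$ is connected. By the Leibniz rule, write $$\sum_I(-1)^{|I|}D_x^I\circ\frac{\partial F}{\partial u_{0,I}}+\sum_{s=1}^{h-1}(-1)^sD_t^s\circ\frac{\partial F}{\partial u_{s,0}}=\sum_{|I|\le N}f_I\,D_x^I+\sum_{s=1}^{h-1}g_s\,D_t^s ,$$ and let $O=\max_{I,s}\{-1,\ \mathrm o(f_I)-N,\ \mathrm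 o(g_s)-N\}$. If $N+h$ is odd, then the equation has no conservation laws of order greater than $O$. -/

import Mathlib

open scoped ContDiff

noncomputable section

namespace GenEvolution

/-- Coordinates on the infinite prolongation of a scalar equation `∂ʰu/∂tʰ = F` in the independent
variables `t, x₁, …, xₙ`: the variables `t`, `xⱼ` and the derivatives
`u_{s,I} = ∂^{s+|I|} u / ∂tˢ∂x^I` with `s < h` and `I` a multi-index. -/
inductive JetVar (n h : ℕ) : Type
  | t : JetVar n h
  | x (j : Fin n) : JetVar n h
  | u (s : Fin h) (I : Fin n → ℕ) : JetVar n h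
  deriving DecidableEq

/-- Points of the infinite prolongation; it carries the product topology. -/
abbrev JetSpace (n h : ℕ) : Type := JetVar n h → ℝ

variable {n h : ℕ}

/-- The length `|I| = i₁ + ⋯ + iₙ` of a multi-index. -/
def len (I : Fin n → ℕ) : ℕ := ∑ i, I i

/-- `f` is, on `U`, a smooth function of finitely many of the coordinates. -/
def SmoothOn (U : Set (JetSpace n h)) (f : JetSpace n h → ℝ) : Prop :=
  ∃ (S : Finset (JetVar n h)) (g : (S → ℝ) → ℝ),
    ContDiffOn ℝ ∞ g ((fun p : JetSpace n h => S.restrict p) '' U) ∧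
      ∀ p ∈ U, f p = g (S.restrict p)

/-- The partial derivative `∂f/∂v` with respect to the coordinate `v`. -/
def pd (v : JetVar n h) (f : JetSpace n h → ℝ) : JetSpace n h → ℝ :=
  fun p => deriv (fun c : ℝ => f (Function.update p v c)) (p v)

/-- The total derivative `D_{x_i} = ∂/∂x_i + ∑_{s,I} u_{s,I+1_i} ∂/∂u_{s,I}`. For a function of
finitely many coordinates the sum is finite. -/
def Dx (i : Fin n) (f : JetSpace n h → ℝ) : JetSpace n h → ℝ :=
  fun p => pd (.x i) f p +
    ∑ᶠ v : Fin h × (Fin n → ℕ), p (.u v.1 (v.2 + Pi.single i 1)) * pd (.u v.1 v.2) f p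

/-- `D_x^I = D_{x_1}^{i_1} ⋯ D_{x_n}^{i_n}`. -/
def DxPow (I : Fin n → ℕ) (f : JetSpace n h → ℝ) : JetSpace n h → ℝ :=
  (List.finRange n).foldr (fun i g => (Dx i)^[I i] g) f

/-- The value of `∂u_{s,I}/∂t` on the equation `∂ʰu/∂tʰ = F`: it is `u_{s+1,I}` for `s < h - 1` and
`D_x^I F` for `s = h - 1`. -/
def timeDerivCoord (F : JetSpace n h → ℝ) (s : Fin h) (I : Fin n → ℕ) : JetSpace n h → ℝ :=
  fun p => if hs : (s : ℕ) + 1 < h then p (.u ⟨(s : ℕ) + 1, hs⟩ I) else DxPow I F p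

/-- The total derivative `D_t` restricted to the equation `∂ʰu/∂tʰ = F`. -/
def Dt (F : JetSpace n h → ℝ) (f : JetSpace n h → ℝ) : JetSpace n h → ℝ :=
  fun p => pd .t f p +
    ∑ᶠ v : Fin h × (Fin n → ℕ), timeDerivCoord F v.1 v.2 p * pd (.u v.1 v.2) f p

/-- All total derivatives: number `0` is `D_t`, number `i + 1` is `D_{x_i}`. -/
def Dtot (F : JetSpace n h → ℝ) (k : Fin (n + 1)) (f : JetSpace n h → ℝ) : JetSpace n h → ℝ :=
  Fin.cases (Dt F f) (fun i => Dx i f) k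

/-- The order of `f` on `U`: the largest `k` such that `∂f/∂u_{s,I}` is not identically zero for some
`s < h` and some `I` with `|I| = k`, and `-1` if there is none. -/
def order (U : Set (JetSpace n h)) (f : JetSpace n h → ℝ) : ℤ :=
  sSup {k : ℤ | k = -1 ∨
    ∃ (s : Fin h) (I : Fin n → ℕ), k = (len I : ℤ) ∧ ∃ p ∈ U, pd (.u s I) f p ≠ 0}

/-- A conserved current on `U`: an `(n+1)`-tuple `(J₀, J₁, …, Jₙ)` of smooth functions with
`D_t J₀ + ∑ D_{x_i} J_i = 0`. -/
def IsConservedCurrent (U : Set (JetSpace n h)) (F : JetSpace n h → ℝ)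
    (J : Fin (n + 1) → JetSpace n h → ℝ) : Prop :=
  (∀ k, SmoothOn U (J k)) ∧ ∀ p ∈ U, ∑ k, Dtot F k (J k) p = 0

/-- A trivial current on `U`: `J_k = ∑_{l<k} D_l 𝓛_{lk} - ∑_{k<l} D_l 𝓛_{kl}`. -/
def IsTrivialCurrent (U : Set (JetSpace n h)) (F : JetSpace n h → ℝ)
    (J : Fin (n + 1) → JetSpace n h → ℝ) : Prop :=
  ∃ L : Fin (n + 1) → Fin (n + 1) → JetSpace n h → ℝ,
    (∀ k l, k < l → SmoothOn U (L k l)) ∧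
      ∀ k, ∀ p ∈ U, J k p =
        ∑ l ∈ Finset.univ.filter (· < k), Dtot F l (L l k) p -
          ∑ l ∈ Finset.univ.filter (k < ·), Dtot F l (L k l) p

/-- A conservation law on `U`: an equivalence class of conserved currents modulo trivial ones. -/
def IsConservationLaw (U : Set (JetSpace n h)) (F : JetSpace n h → ℝ)
    (C : Set (Fin (n + 1) → JetSpace n h → ℝ)) : Prop :=
  ∃ J, IsConservedCurrent U F J ∧
    C = {J' | IsConservedCurrent U F J' ∧ IsTrivialCurrent U F (J' - J)}

/-- The characteristic `χ = ∑_I (-1)^{|I|} D_x^I (∂J₀/∂u_{h-1,I})` of a current `J`. -/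
def characteristic (hh : 0 < h) (J : Fin (n + 1) → JetSpace n h → ℝ) : JetSpace n h → ℝ :=
  fun p => ∑ᶠ I : Fin n → ℕ,
    (-1 : ℝ) ^ len I * DxPow I (pd (.u ⟨h - 1, Nat.sub_one_lt_of_lt hh⟩ I) (J 0)) p

/-- `k` is the order of the conservation law `C`, that is, of the characteristic of a current
representing it. -/
def LawHasOrder (hh : 0 < h) (U : Set (JetSpace n h)) (C : Set (Fin (n + 1) → JetSpace n h → ℝ))
    (k : ℤ) : Prop :=
  ∃ J ∈ C, order U (characteristic hh J) = k

/-!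
The adjoint linearization of `F` is the operator
`L = ∑_I (-1)^{|I|} D_x^I ∘ ∂F/∂u_{0,I} + ∑_{1 ≤ r < h} (-1)^r D_t^r ∘ ∂F/∂u_{r,0}`.
Moving the derivations to the right by the Leibniz rule, one gets
`L = ∑_K f_K D_x^K + ∑_{1 ≤ s < h} g_s D_t^s` with the coefficients below.
-/

/-- The coefficient of `D_t^s` in `∑_{1 ≤ r < h} (-1)^r D_t^r ∘ ∂F/∂u_{r,0}`. -/
def timeCoeff (F : JetSpace n h → ℝ) (s : ℕ) : JetSpace n h → ℝ :=
  fun p => ∑ r ∈ Finset.univ.filter (fun r : Fin h => 1 ≤ (r : ℕ)),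
    (-1 : ℝ) ^ (r : ℕ) * ((r : ℕ).choose s : ℝ) * (Dt F)^[(r : ℕ) - s] (pd (.u r 0) F) p

/-- The coefficient `f_K` of `D_x^K` in `L`; the free term `f_0` of `L` gets contributions from both
sums. -/
def spaceCoeff (hh : 0 < h) (F : JetSpace n h → ℝ) (K : Fin n → ℕ) : JetSpace n h → ℝ :=
  fun p => (∑ᶠ I : Fin n → ℕ,
    (-1 : ℝ) ^ len I * ((∏ i, (I i).choose (K i) : ℕ) : ℝ) *
      DxPow (I - K) (pd (.u ⟨0, hh⟩ I) F) p) + if K = 0 then timeCoeff F 0 p else 0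

/-- The number `O`: the maximum of `-1`, of `o(f_K) - N` for `|K| ≤ N` and of `o(g_s) - N` for
`1 ≤ s < h`. -/
def boundO (hh : 0 < h) (U : Set (JetSpace n h)) (F : JetSpace n h → ℝ) (N : ℕ) : ℤ :=
  sSup {k : ℤ | k = -1 ∨
    (∃ K : Fin n → ℕ, len K ≤ N ∧ k = order U (spaceCoeff hh F K) - N) ∨
      ∃ s : ℕ, 1 ≤ s ∧ s < h ∧ k = order U (timeCoeff F s) - N}

/-- The set of points of `U` at which the symbol `A = ∑_{|I|=N} (∂F/∂u_{0,I}) q^I` of the right-hand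
side is a nonzero polynomial in `q₁, …, qₙ`. -/
def symbolNonzero (hh : 0 < h) (U : Set (JetSpace n h)) (F : JetSpace n h → ℝ) (N : ℕ) :
    Set (JetSpace n h) :=
  {p ∈ U | ∃ I : Fin n → ℕ, len I = N ∧ pd (.u ⟨0, hh⟩ I) F p ≠ 0}

end GenEvolution

end

/-!
Applying the adjoints of the linearizations to `D_t J₀ + ∑ D_{x_i} J_i = 0` shows that the
characteristic `χ` satisfies `(-1)^h D_t^h χ = L χ`, where `L` is the operator whose normal form has
the coefficients `f_K` and `g_s`.

Suppose that `χ` has order `k > O`, and let `c` be the largest `s` for which the symbol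
`σ = ∑_{|I| = k} ∂χ/∂u_{s,I} q^I` is nonzero. Compare the degree `k + N` symbols of the two sides
with respect to the variables `u_{c,I}`. One application of `D_t` moves a symbol from `u_{s,I}` to
`u_{s+1,I}`, and from `u_{h-1,I}` to `u_{0,I}` with a factor `A`, so that the left-hand side
contributes `(-1)^h A σ`. On the right-hand side the derivatives of the coefficients of `L` do not
contribute, because these coefficients have order at most `O + N < k + N`; neither do the terms with
`g_s D_t^s`, since `s < h` applications of `D_t` do not lead back to `u_{c,I}`; the terms
`f_K D_x^K` with `|K| = N` contribute `(-1)^N A σ`. As `N + h` is odd, `2 A σ = 0`. Polynomials over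
`ℝ` have no zero divisors and `A` is nonzero on a dense subset of `U`, so `σ = 0`.
-/

noncomputable section

open scoped ContDiff

namespace GenEvolution

section MultiIndex

variable {n : ℕ}

theorem len_eq_zero {I : Fin n → ℕ} : len I = 0 ↔ I = 0 := by
  simp [len, funext_iff]

theorem len_add (I J : Fin n → ℕ) : len (I + J) = len I + len J := Finset.sum_add_distrib

theorem len_single (i : Fin n) : len (Pi.single i 1) = 1 := by simp [len]

theorem len_mono {I J : Fin n → ℕ} (hIJ : I ≤ J) : len I ≤ len J :=
  Finset.sum_le_sum fun i _ => hIJ i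

theorem eq_of_le_of_len_le {I J : Fin n → ℕ} (hIJ : I ≤ J) (hlen : len J ≤ len I) : I = J := by
  have hadd : len I + len (J - I) = len J := by rw [← len_add, add_tsub_cancel_of_le hIJ]
  have hsub : J - I = 0 := len_eq_zero.1 (by omega)
  exact le_antisymm hIJ (tsub_eq_zero_iff_le.1 hsub)

theorem exists_eq_add_single {I : Fin n → ℕ} {i : Fin n} (hi : I i ≠ 0) :
    ∃ J : Fin n → ℕ, I = J + Pi.single i 1 := by
  refine ⟨I - Pi.single i 1, (tsub_add_cancel_of_le fun j => ?_).symm⟩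
  rcases eq_or_ne j i with rfl | hj
  · simpa using Nat.one_le_iff_ne_zero.2 hi
  · simp [hj]

theorem multiIndex_induction {P : (Fin n → ℕ) → Prop} (zero : P 0)
    (add_single : ∀ I i, P I → P (I + Pi.single i 1)) (I : Fin n → ℕ) : P I := by
  induction hm : len I generalizing I with
  | zero => exact len_eq_zero.1 hm ▸ zero
  | succ m ih =>
    obtain ⟨i, -, hi⟩ : ∃ i ∈ Finset.univ, I i ≠ 0 :=
      Finset.exists_ne_zero_of_sum_ne_zero (ne_of_eq_of_ne hm m.succ_ne_zero)
    obtain ⟨J, rfl⟩ := exists_eq_add_single hi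
    rw [len_add, len_single] at hm
    exact add_single J i (ih J (by omega))

/-- The finite set of multi-indices of length at most `N`. -/
def lenLE (N : ℕ) : Finset (Fin n → ℕ) :=
  (Finset.range (N + 1)).biUnion (Finset.piAntidiag Finset.univ)

theorem mem_lenLE {N : ℕ} {I : Fin n → ℕ} : I ∈ lenLE N ↔ len I ≤ N := by
  simp [lenLE, Finset.mem_piAntidiag, len]

/-- The multi-index binomial coefficient `∏ᵢ (Iᵢ choose Kᵢ)`. -/
def multiChoose (I K : Fin n → ℕ) : ℕ := ∏ i, (I i).choose (K i)

theorem multiChoose_self (I : Fin n → ℕ) : multiChoose I I = 1 := by simp [multiChoose]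

theorem multiChoose_eq_zero {I K : Fin n → ℕ} (hK : ¬ K ≤ I) : multiChoose I K = 0 := by
  simp only [Pi.le_def, not_forall, not_le] at hK
  obtain ⟨j, hj⟩ := hK
  exact Finset.prod_eq_zero (Finset.mem_univ j) (Nat.choose_eq_zero_of_lt hj)

theorem multiChoose_eq_mul_erase (I K : Fin n → ℕ) (i : Fin n) :
    multiChoose I K = (I i).choose (K i) * ∏ j ∈ Finset.univ.erase i, (I j).choose (K j) :=
  (Finset.mul_prod_erase _ (fun j => (I j).choose (K j)) (Finset.mem_univ i)).symm

theorem prod_erase_choose_congr {I I' K K' : Fin n → ℕ} {i : Fin n} (hI : ∀ j ≠ i, I j = I' j)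
    (hK : ∀ j ≠ i, K j = K' j) :
    ∏ j ∈ Finset.univ.erase i, (I j).choose (K j) =
      ∏ j ∈ Finset.univ.erase i, (I' j).choose (K' j) :=
  Finset.prod_congr rfl fun j hj => by
    rw [hI j (Finset.ne_of_mem_erase hj), hK j (Finset.ne_of_mem_erase hj)]

theorem multiChoose_add_single_add_single (I K : Fin n → ℕ) (i : Fin n) :
    multiChoose (I + Pi.single i 1) (K + Pi.single i 1) =
      multiChoose I K + multiChoose I (K + Pi.single i 1) := by
  have hne : ∀ (J : Fin n → ℕ), ∀ j ≠ i, (J + Pi.single i 1 : Fin n → ℕ) j = J j :=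
    fun J j hj => by simp [hj]
  simp only [multiChoose_eq_mul_erase _ _ i]
  rw [prod_erase_choose_congr (hne I) (hne K), prod_erase_choose_congr (fun _ _ => rfl) (hne K)]
  simp [Nat.choose_succ_succ, add_mul]

theorem multiChoose_add_single_of_eq_zero {I K : Fin n → ℕ} {i : Fin n} (hK : K i = 0) :
    multiChoose (I + Pi.single i 1) K = multiChoose I K := by
  refine Finset.prod_congr rfl fun j _ => ?_
  rcases eq_or_ne j i with rfl | hj
  · simp [hK]
  · simp [hj]

variable {M : Type*} [AddCommMonoid M]

theorem sum_Iic_multiChoose_of_le {I J : Fin n → ℕ} (hIJ : I ≤ J) (φ : (Fin n → ℕ) → M) :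
    ∑ K ∈ Finset.Iic J, multiChoose I K • φ K = ∑ K ∈ Finset.Iic I, multiChoose I K • φ K := by
  refine (Finset.sum_subset (Finset.Iic_subset_Iic.2 hIJ) fun K _ hK => ?_).symm
  rw [multiChoose_eq_zero (by simpa using hK), zero_smul]

theorem Iic_add_single (I : Fin n → ℕ) (i : Fin n) :
    Finset.Iic (I + Pi.single i 1) = (Finset.Iic (I + Pi.single i 1)).filter (· i = 0) ∪
      (Finset.Iic I).map (addRightEmbedding (Pi.single i 1)) := by
  ext K
  simp only [Finset.mem_union, Finset.mem_filter, Finset.mem_map, Finset.mem_Iic,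
    addRightEmbedding_apply]
  constructor
  · intro hK
    by_cases hi : K i = 0
    · exact .inl ⟨hK, hi⟩
    · obtain ⟨J, rfl⟩ := exists_eq_add_single hi
      exact .inr ⟨J, by simpa using hK, rfl⟩
  · rintro (⟨hK, -⟩ | ⟨J, hJ, rfl⟩)
    · exact hK
    · simpa using hJ

theorem sum_Iic_add_single (I : Fin n → ℕ) (i : Fin n) (φ : (Fin n → ℕ) → M) :
    ∑ K ∈ Finset.Iic (I + Pi.single i 1), φ K =
      ∑ K ∈ (Finset.Iic (I + Pi.single i 1)).filter (· i = 0), φ K +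
        ∑ K ∈ Finset.Iic I, φ (K + Pi.single i 1) := by
  rw [Iic_add_single, Finset.sum_union, Finset.sum_map, ← Iic_add_single]
  · rfl
  · rw [Finset.disjoint_left]
    rintro K hK hK'
    obtain ⟨J, -, rfl⟩ := Finset.mem_map.1 hK'
    simp at hK

theorem sum_multiChoose_add_single (I : Fin n → ℕ) (i : Fin n) (φ : (Fin n → ℕ) → M) :
    ∑ K ∈ Finset.Iic (I + Pi.single i 1), multiChoose (I + Pi.single i 1) K • φ K =
      ∑ K ∈ Finset.Iic I, multiChoose I K • (φ K + φ (K + Pi.single i 1)) := by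
  have hzero : ∀ K ∈ (Finset.Iic (I + Pi.single i 1)).filter (· i = 0),
      multiChoose (I + Pi.single i 1) K • φ K = multiChoose I K • φ K := fun K hK => by
    rw [multiChoose_add_single_of_eq_zero (Finset.mem_filter.1 hK).2]
  calc ∑ K ∈ Finset.Iic (I + Pi.single i 1), multiChoose (I + Pi.single i 1) K • φ K
      = ∑ K ∈ Finset.Iic (I + Pi.single i 1), multiChoose I K • φ K +
          ∑ K ∈ Finset.Iic I, multiChoose I K • φ (K + Pi.single i 1) := by
        rw [sum_Iic_add_single, Finset.sum_congr rfl hzero,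
          sum_Iic_add_single I i fun K => multiChoose I K • φ K]
        simp only [multiChoose_add_single_add_single, add_smul, Finset.sum_add_distrib]
        abel
    _ = ∑ K ∈ Finset.Iic I, multiChoose I K • (φ K + φ (K + Pi.single i 1)) := by
        rw [sum_Iic_multiChoose_of_le le_self_add]
        simp only [smul_add, Finset.sum_add_distrib]

end MultiIndex

section MultiPow

variable {n : ℕ} {M : Type*} [Monoid M] {a : Fin n → M}

/-- The product `a₁ ^ I₁ ⋯ aₙ ^ Iₙ`, in this order. -/
def multiPow (a : Fin n → M) (I : Fin n → ℕ) : M :=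
  ((List.finRange n).map fun i => a i ^ I i).prod

theorem multiPow_zero (a : Fin n → M) : multiPow a 0 = 1 := by
  simp [multiPow]

theorem commute_multiPow {b : M} (hb : ∀ i, Commute b (a i)) (I : Fin n → ℕ) :
    Commute b (multiPow a I) := by
  refine Commute.list_prod_right _ _ fun x hx => ?_
  obtain ⟨i, -, rfl⟩ := List.mem_map.1 hx
  exact (hb i).pow_right _

theorem multiPow_add_single (ha : ∀ i j, Commute (a i) (a j)) (I : Fin n → ℕ) (i : Fin n) :
    multiPow a (I + Pi.single i 1) = a i * multiPow a I := by
  suffices ∀ l : List (Fin n), l.Nodup →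
      (l.map fun j => a j ^ (I + Pi.single i 1 : Fin n → ℕ) j).prod =
        (if i ∈ l then a i else 1) * (l.map fun j => a j ^ I j).prod by
    simpa [multiPow] using this _ (List.nodup_finRange n)
  intro l hl
  induction l with
  | nil => simp
  | cons j l ih =>
    rw [List.nodup_cons] at hl
    rw [List.map_cons, List.prod_cons, ih hl.2, List.map_cons, List.prod_cons]
    rcases eq_or_ne j i with rfl | hj
    · simp [hl.1, pow_succ', mul_assoc]
    · by_cases hil : i ∈ l
      · simp [hil, hj, hj.symm, ← mul_assoc, ((ha i j).pow_right _).eq]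
      · simp [hil, hj, hj.symm]

end MultiPow

section Leibniz

variable {𝕜 R : Type*} [CommRing 𝕜] [CommRing R] [Algebra 𝕜 R] {n : ℕ}

theorem derivation_pow_succ_apply (D : Derivation 𝕜 R R) (r : ℕ) (a : R) :
    ((D : Module.End 𝕜 R) ^ (r + 1)) a = D (((D : Module.End 𝕜 R) ^ r) a) := by
  rw [pow_succ', Module.End.mul_apply, Derivation.coeFn_coe]

theorem derivation_pow_mul (D : Derivation 𝕜 R R) (r : ℕ) (a b : R) :
    ((D : Module.End 𝕜 R) ^ r) (a * b) = ∑ j ∈ Finset.range (r + 1),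
      r.choose j • (((D : Module.End 𝕜 R) ^ (r - j)) a * ((D : Module.End 𝕜 R) ^ j) b) := by
  induction r with
  | zero => simp
  | succ r ih =>
    rw [derivation_pow_succ_apply, ih, map_sum, Finset.sum_choose_succ_nsmul (fun j k =>
      ((D : Module.End 𝕜 R) ^ k) a * ((D : Module.End 𝕜 R) ^ j) b), ← Finset.sum_add_distrib]
    refine Finset.sum_congr rfl fun j hj => ?_
    rw [Nat.sub_add_comm (Finset.mem_range_succ_iff.1 hj), map_nsmul, ← smul_add]
    simp only [derivation_pow_succ_apply, Derivation.leibniz, smul_eq_mul]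
    ring

theorem multiPow_derivation_mul {D : Fin n → Derivation 𝕜 R R}
    (hD : ∀ i j, Commute (D i : Module.End 𝕜 R) (D j)) (I : Fin n → ℕ) (a b : R) :
    multiPow (fun i => (D i : Module.End 𝕜 R)) I (a * b) = ∑ K ∈ Finset.Iic I,
      multiChoose I K • (multiPow (fun i => (D i : Module.End 𝕜 R)) (I - K) a *
        multiPow (fun i => (D i : Module.End 𝕜 R)) K b) := by
  set P := multiPow (fun i => (D i : Module.End 𝕜 R)) with hP
  have hsucc : ∀ J i c, P (J + Pi.single i 1) c = D i (P J c) := fun J i c => by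
    rw [hP, multiPow_add_single hD, Module.End.mul_apply, Derivation.coeFn_coe]
  induction I using multiIndex_induction with
  | zero =>
    have hIic : Finset.Iic (0 : Fin n → ℕ) = {0} := Finset.Iic_bot
    simp [hIic, hP, multiPow_zero, multiChoose_self]
  | add_single I i ih =>
    rw [hsucc, ih, map_sum, sum_multiChoose_add_single]
    refine Finset.sum_congr rfl fun K hK => ?_
    rw [map_nsmul, Derivation.leibniz, add_tsub_add_eq_tsub_right,
      ← tsub_add_eq_add_tsub (Finset.mem_Iic.1 hK), hsucc, hsucc, smul_eq_mul, smul_eq_mul]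
    ring

end Leibniz

theorem neg_one_pow_smul_pow_last_eq_sum {𝕜 M : Type*} [CommRing 𝕜] [AddCommGroup M] [Module 𝕜 M]
    (T : Module.End 𝕜 M) {m : ℕ} (p a : Fin (m + 1) → M) (hzero : T (p 0) + a 0 = 0)
    (hsucc : ∀ s : Fin m, T (p s.succ) + p s.castSucc + a s.succ = 0) :
    (-1 : 𝕜) ^ (m + 1) • (T ^ (m + 1)) (p (Fin.last m)) =
      ∑ s : Fin (m + 1), (-1 : 𝕜) ^ (s : ℕ) • (T ^ (s : ℕ)) (a s) := by
  set g : Fin (m + 1) → M := fun s => (-1 : 𝕜) ^ (s + 1 : ℕ) • (T ^ (s + 1 : ℕ)) (p s) with hg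
  have hT : ∀ (j : ℕ) x, (T ^ j) (T x) = (T ^ (j + 1)) x := fun j x => by
    rw [pow_succ, Module.End.mul_apply]
  have ha_zero : a 0 = g 0 := by simp [hg, eq_neg_of_add_eq_zero_right hzero]
  have ha_succ : ∀ s : Fin m, (-1 : 𝕜) ^ (s + 1 : ℕ) • (T ^ (s + 1 : ℕ)) (a s.succ) =
      g s.succ - g s.castSucc := fun s => by
    rw [eq_neg_of_add_eq_zero_right (hsucc s), map_neg, map_add, hT, hg]
    simp only [Fin.val_succ, Fin.val_castSucc, pow_succ _ (s + 1 : ℕ), mul_neg_one, neg_smul]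
    module
  have hsum : g 0 + ∑ s : Fin m, g s.succ = ∑ s : Fin m, g s.castSucc + g (Fin.last m) := by
    rw [← Fin.sum_univ_succ, ← Fin.sum_univ_castSucc]
  rw [Fin.sum_univ_succ]
  simp only [Fin.val_succ, ha_succ, Finset.sum_sub_distrib]
  rw [Fin.val_zero, pow_zero, pow_zero, one_smul, Module.End.one_apply, ha_zero, ← add_sub_assoc,
    hsum, add_sub_cancel_left, hg]
  rfl

/-- An algebra with the differential structure of the algebra of smooth functions of finitely many
of the coordinates indexed by `V`: the partial derivatives `der v` and the coordinates `X v`. -/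
structure CoordAlgebra (𝕜 V R : Type*) [DecidableEq V] [CommRing 𝕜] [CommRing R]
    [Algebra 𝕜 R] where
  der : V → Derivation 𝕜 R R
  X : V → R
  der_comm : ∀ v w f, der v (der w f) = der w (der v f)
  der_X : ∀ v w, der v (X w) = if v = w then 1 else 0
  finite_der : ∀ f, {v | der v f ≠ 0}.Finite

namespace CoordAlgebra

section Field

variable {𝕜 V R : Type*} [DecidableEq V] [CommRing 𝕜] [CommRing R] [Algebra 𝕜 R]
  (𝓐 : CoordAlgebra 𝕜 V R) (a b : V → R)

theorem finite_support_mul_der (f : R) : (Function.support fun v => a v * 𝓐.der v f).Finite :=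
  (𝓐.finite_der f).subset fun _ hv hder => hv (by simp [hder])

/-- The vector field `∑ᵥ a_v ∂/∂v`, a locally finite sum. -/
def field : Derivation 𝕜 R R :=
  .mk'
    { toFun := fun f => ∑ᶠ v, a v * 𝓐.der v f
      map_add' := fun f g => by
        rw [← finsum_add_distrib (𝓐.finite_support_mul_der a f) (𝓐.finite_support_mul_der a g)]
        simp only [map_add, mul_add]
      map_smul' := fun c f => by
        rw [RingHom.id_apply, smul_finsum' c (𝓐.finite_support_mul_der a f)]
        simp only [Derivation.map_smul, mul_smul_comm] }
    fun f g => by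
      simp only [LinearMap.coe_mk, AddHom.coe_mk, smul_eq_mul]
      rw [mul_finsum' _ f (𝓐.finite_support_mul_der a g),
        mul_finsum' _ g (𝓐.finite_support_mul_der a f)]
      simp only [← mul_assoc]
      rw [← finsum_add_distrib (𝓐.finite_support_mul_der (fun v => f * a v) g)
        (𝓐.finite_support_mul_der (fun v => g * a v) f)]
      exact finsum_congr fun v => by rw [Derivation.leibniz, smul_eq_mul, smul_eq_mul]; ring

theorem field_apply (f : R) : 𝓐.field a f = ∑ᶠ v, a v * 𝓐.der v f := rfl

theorem field_add (f : R) : 𝓐.field (a + b) f = 𝓐.field a f + 𝓐.field b f := by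
  simp only [field_apply, Pi.add_apply, add_mul]
  exact finsum_add_distrib (𝓐.finite_support_mul_der a f) (𝓐.finite_support_mul_der b f)

theorem field_single (v : V) (r f : R) : 𝓐.field (Pi.single v r) f = r * 𝓐.der v f := by
  rw [field_apply, finsum_eq_single _ v fun w hw => by simp [hw], Pi.single_eq_same]

theorem field_extend {ι : Type*} {e : ι → V} (he : Function.Injective e) (c : ι → R) (f : R) :
    𝓐.field (Function.extend e c 0) f = ∑ᶠ j, c j * 𝓐.der (e j) f := by
  have hrange := finsum_mem_range (f := fun w => Function.extend e c 0 w * 𝓐.der w f) he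
  simp only [he.extend_apply] at hrange
  rw [field_apply, ← hrange]
  refine finsum_congr fun w => ?_
  by_cases hw : w ∈ Set.range e
  · simp only [hw, finsum_true]
  · rw [Function.extend_apply' _ _ _ hw, Pi.zero_apply, zero_mul]
    simp

theorem field_eq_sum {f : R} {S : Finset V} (hS : ∀ v ∉ S, 𝓐.der v f = 0) :
    𝓐.field a f = ∑ v ∈ S, a v * 𝓐.der v f :=
  finsum_eq_sum_of_support_subset _ fun v hv => by
    by_contra hvS
    exact hv (by simp [hS v hvS])

theorem field_X (v : V) : 𝓐.field a (𝓐.X v) = a v := by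
  rw [𝓐.field_eq_sum a (S := {v}) fun w hw => by rw [𝓐.der_X, if_neg (by simpa using hw)]]
  simp [𝓐.der_X]

theorem exists_finset_der (f : R) : ∃ S : Finset V, ∀ v ∉ S, 𝓐.der v f = 0 :=
  ⟨(𝓐.finite_der f).toFinset, fun v hv => by simpa using hv⟩

theorem der_der_eq_zero {f : R} {v : V} (hv : 𝓐.der v f = 0) (w : V) :
    𝓐.der v (𝓐.der w f) = 0 := by
  rw [𝓐.der_comm, hv, map_zero]

theorem der_field (v : V) (f : R) : 𝓐.der v (𝓐.field a f) =
    𝓐.field a (𝓐.der v f) + 𝓐.field (fun w => 𝓐.der v (a w)) f := by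
  obtain ⟨S, hS⟩ := 𝓐.exists_finset_der f
  rw [𝓐.field_eq_sum _ hS, 𝓐.field_eq_sum _ hS,
    𝓐.field_eq_sum _ fun w hw => 𝓐.der_der_eq_zero (hS w hw) v, map_sum, ← Finset.sum_add_distrib]
  refine Finset.sum_congr rfl fun w _ => ?_
  rw [Derivation.leibniz, smul_eq_mul, smul_eq_mul, 𝓐.der_comm v w]
  ring

variable {a b}

theorem field_comm (hab : ∀ v, 𝓐.field a (b v) = 𝓐.field b (a v)) (f : R) :
    𝓐.field a (𝓐.field b f) = 𝓐.field b (𝓐.field a f) := by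
  obtain ⟨S, hS⟩ := 𝓐.exists_finset_der f
  have happly : ∀ a b : V → R, 𝓐.field a (𝓐.field b f) =
      ∑ w ∈ S, 𝓐.field a (b w) * 𝓐.der w f +
        ∑ w ∈ S, ∑ v ∈ S, b w * a v * 𝓐.der v (𝓐.der w f) := fun a b => by
    rw [𝓐.field_eq_sum b hS, map_sum, ← Finset.sum_add_distrib]
    refine Finset.sum_congr rfl fun w _ => ?_
    rw [Derivation.leibniz, 𝓐.field_eq_sum a fun v hv => 𝓐.der_der_eq_zero (hS v hv) w,
      smul_eq_mul, smul_eq_mul, Finset.mul_sum]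
    simp only [mul_assoc]
    ring
  rw [happly, happly, Finset.sum_comm (s := S) (t := S)]
  simp only [hab, mul_comm (b _) (a _), 𝓐.der_comm]

end Field
section Dx

variable {𝕜 R : Type*} [CommRing 𝕜] [CommRing R] [Algebra 𝕜 R] {n h : ℕ}
  (𝓐 : CoordAlgebra 𝕜 (JetVar n h) R)

/-- The partial derivative `∂/∂u_{s,I}`. -/
abbrev du (s : Fin h) (I : Fin n → ℕ) : Derivation 𝕜 R R := 𝓐.der (.u s I)

/-- `f` depends on no `u_{s,I}` with `|I| > k`. -/
def RowOrderLE (s : Fin h) (k : ℕ) (f : R) : Prop := ∀ I, k < len I → 𝓐.du s I f = 0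

/-- The components of the vector field `D_{x_i}`. -/
def dxCoeff (i : Fin n) : JetVar n h → R
  | .t => 0
  | .x j => if j = i then 1 else 0
  | .u s I => 𝓐.X (.u s (I + Pi.single i 1))

/-- The total derivative `D_{x_i}`. -/
def Dx (i : Fin n) : Derivation 𝕜 R R := 𝓐.field (𝓐.dxCoeff i)

/-- The iterated total derivative `D_x^I`. -/
def DxPow (I : Fin n → ℕ) : Module.End 𝕜 R := multiPow (fun i => (𝓐.Dx i : Module.End 𝕜 R)) I

theorem Dx_comm (i j : Fin n) (f : R) : 𝓐.Dx i (𝓐.Dx j f) = 𝓐.Dx j (𝓐.Dx i f) := by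
  refine 𝓐.field_comm (fun v => ?_) f
  cases v with
  | t => simp [dxCoeff]
  | x l => simp [dxCoeff, apply_ite]
  | u s I => simp [dxCoeff, field_X, add_right_comm]

theorem commute_Dx (i j : Fin n) : Commute (𝓐.Dx i : Module.End 𝕜 R) (𝓐.Dx j) :=
  LinearMap.ext fun f => 𝓐.Dx_comm i j f

theorem DxPow_zero_apply (f : R) : 𝓐.DxPow 0 f = f := by
  rw [DxPow, multiPow_zero, Module.End.one_apply]

theorem DxPow_add_single_apply (I : Fin n → ℕ) (i : Fin n) (f : R) :
    𝓐.DxPow (I + Pi.single i 1) f = 𝓐.Dx i (𝓐.DxPow I f) := by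
  rw [DxPow, multiPow_add_single 𝓐.commute_Dx]
  rfl

theorem DxPow_Dx (I : Fin n → ℕ) (i : Fin n) (f : R) :
    𝓐.DxPow I (𝓐.Dx i f) = 𝓐.DxPow (I + Pi.single i 1) f := by
  rw [DxPow_add_single_apply]
  exact (LinearMap.congr_fun (commute_multiPow (𝓐.commute_Dx i) I) f).symm

theorem DxPow_mul (I : Fin n → ℕ) (f g : R) : 𝓐.DxPow I (f * g) =
    ∑ K ∈ Finset.Iic I, multiChoose I K • (𝓐.DxPow (I - K) f * 𝓐.DxPow K g) :=
  multiPow_derivation_mul 𝓐.commute_Dx I f g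

theorem du_add_single_Dx (s : Fin h) (I : Fin n → ℕ) (i : Fin n) (f : R) :
    𝓐.du s (I + Pi.single i 1) (𝓐.Dx i f) =
      𝓐.Dx i (𝓐.du s (I + Pi.single i 1) f) + 𝓐.du s I f := by
  have hcoeff : (fun w => 𝓐.du s (I + Pi.single i 1) (𝓐.dxCoeff i w)) = Pi.single (.u s I) 1 := by
    funext w
    cases w with
    | t => simp [dxCoeff]
    | x l => simp [dxCoeff, apply_ite]
    | u s' I' => simp [dxCoeff, 𝓐.der_X, Pi.single_apply, eq_comm]
  rw [Dx, du, der_field, hcoeff, field_single, one_mul]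

theorem du_Dx_of_eq_zero {I : Fin n → ℕ} {i : Fin n} (hI : I i = 0) (s : Fin h) (f : R) :
    𝓐.du s I (𝓐.Dx i f) = 𝓐.Dx i (𝓐.du s I f) := by
  have hcoeff : (fun w => 𝓐.du s I (𝓐.dxCoeff i w)) = 0 := by
    funext w
    cases w with
    | t => simp [dxCoeff]
    | x l => simp [dxCoeff, apply_ite]
    | u s' I' =>
      have hne : I ≠ I' + Pi.single i 1 := fun hII' => by simp [hII'] at hI
      simp [dxCoeff, 𝓐.der_X, hne]
  have hzero : 𝓐.field 0 f = 0 := by simp [field_apply]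
  rw [Dx, du, der_field, hcoeff, hzero, add_zero]

end Dx

section Dt

variable {𝕜 R : Type*} [CommRing 𝕜] [CommRing R] [Algebra 𝕜 R] {n m : ℕ}
  (𝓐 : CoordAlgebra 𝕜 (JetVar n (m + 1)) R) (F : R)

/-- The components of the vector field `D_t` on the equation `∂ᵐ⁺¹u/∂tᵐ⁺¹ = F`. -/
def dtCoeff : JetVar n (m + 1) → R
  | .t => 1
  | .x _ => 0
  | .u s I => Fin.lastCases (𝓐.DxPow I F) (fun s => 𝓐.X (.u s.succ I)) s

/-- The total derivative `D_t` on the equation `∂ᵐ⁺¹u/∂tᵐ⁺¹ = F`. -/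
def Dt : Derivation 𝕜 R R := 𝓐.field (𝓐.dtCoeff F)

/-- The iterated total derivative `D_t^j`. -/
def DtPow (j : ℕ) : Module.End 𝕜 R := (𝓐.Dt F : Module.End 𝕜 R) ^ j

theorem Dt_Dx (i : Fin n) (f : R) : 𝓐.Dt F (𝓐.Dx i f) = 𝓐.Dx i (𝓐.Dt F f) := by
  refine 𝓐.field_comm (fun v => ?_) f
  cases v with
  | t => simp [dxCoeff, dtCoeff]
  | x l => simp [dxCoeff, dtCoeff, apply_ite]
  | u s I =>
    cases s using Fin.lastCases with
    | last => simp [dxCoeff, dtCoeff, field_X, DxPow_add_single_apply, Dx]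
    | cast s => simp [dxCoeff, dtCoeff, field_X]

theorem Dt_DxPow (I : Fin n → ℕ) (f : R) :
    𝓐.Dt F (𝓐.DxPow I f) = 𝓐.DxPow I (𝓐.Dt F f) :=
  LinearMap.congr_fun
    (commute_multiPow (b := (𝓐.Dt F : Module.End 𝕜 R)) (fun i => LinearMap.ext (𝓐.Dt_Dx F i)) I) f

theorem DtPow_zero_apply (f : R) : 𝓐.DtPow F 0 f = f := rfl

theorem DtPow_succ_apply (j : ℕ) (f : R) : 𝓐.DtPow F (j + 1) f = 𝓐.Dt F (𝓐.DtPow F j f) :=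
  derivation_pow_succ_apply _ j f

theorem DtPow_mul (r : ℕ) (f g : R) : 𝓐.DtPow F r (f * g) =
    ∑ j ∈ Finset.range (r + 1), r.choose j • (𝓐.DtPow F (r - j) f * 𝓐.DtPow F j g) :=
  derivation_pow_mul _ r f g

theorem u_last_injective :
    Function.Injective (JetVar.u (Fin.last m) : (Fin n → ℕ) → JetVar n (m + 1)) :=
  fun J J' => by simp

theorem du_dtCoeff (s : Fin (m + 1)) (I : Fin n → ℕ) :
    (fun w => 𝓐.du s I (𝓐.dtCoeff F w)) =
      Fin.cases (motive := fun _ => JetVar n (m + 1) → R) 0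
          (fun s => Pi.single (.u s.castSucc I) 1) s +
        Function.extend (JetVar.u (Fin.last m)) (fun J => 𝓐.du s I (𝓐.DxPow J F)) 0 := by
  funext w
  cases w with
  | t => cases s using Fin.cases <;> simp [dtCoeff]
  | x l => cases s using Fin.cases <;> simp [dtCoeff]
  | u s' J =>
    cases s' using Fin.lastCases with
    | last =>
      cases s using Fin.cases <;>
        simp [dtCoeff, u_last_injective.extend_apply, Fin.castSucc_ne_last, eq_comm]
    | cast s' =>
      cases s using Fin.cases <;>
        simp [dtCoeff, 𝓐.der_X, Pi.single_apply, Fin.succ_ne_zero, eq_comm]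

theorem du_Dt (s : Fin (m + 1)) (I : Fin n → ℕ) (f : R) : 𝓐.du s I (𝓐.Dt F f) =
    𝓐.Dt F (𝓐.du s I f) +
      Fin.cases (motive := fun _ => R) 0 (fun s => 𝓐.du s.castSucc I f) s +
      ∑ᶠ J, 𝓐.du s I (𝓐.DxPow J F) * 𝓐.du (Fin.last m) J f := by
  rw [Dt, du, der_field, du_dtCoeff, field_add, 𝓐.field_extend u_last_injective, add_assoc]
  cases s using Fin.cases with
  | zero => simp [field_apply]
  | succ s => simp [field_single]

end Dt
section FormalAdjoint

variable {𝕜 R : Type*} [CommRing 𝕜] [CommRing R] [Algebra 𝕜 R] {n h : ℕ}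
  (𝓐 : CoordAlgebra 𝕜 (JetVar n h) R)

/-- The formal adjoint `g ↦ ∑_I (-1)^{|I|} D_x^I (c_I g)` of the operator `∑_I c_I D_x^I`. -/
def formalAdjoint : ((Fin n → ℕ) →₀ R) →ₗ[𝕜] Module.End 𝕜 R :=
  Finsupp.lsum 𝕜 fun I => (-1 : 𝕜) ^ len I • (LinearMap.mul 𝕜 R).compr₂ (𝓐.DxPow I)

theorem formalAdjoint_single (I : Fin n → ℕ) (a g : R) :
    𝓐.formalAdjoint (.single I a) g = (-1 : 𝕜) ^ len I • 𝓐.DxPow I (a * g) := by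
  simp [formalAdjoint]

theorem formalAdjoint_apply (c : (Fin n → ℕ) →₀ R) (g : R) :
    𝓐.formalAdjoint c g = c.sum fun I a => (-1 : 𝕜) ^ len I • 𝓐.DxPow I (a * g) := by
  simp [formalAdjoint, Finsupp.sum, LinearMap.sum_apply]

theorem formalAdjoint_smul (b : R) (c : (Fin n → ℕ) →₀ R) (g : R) :
    𝓐.formalAdjoint (b • c) g = 𝓐.formalAdjoint c (b * g) := by
  induction c using Finsupp.induction_linear with
  | zero => simp
  | add c c' hc hc' => simp only [smul_add, map_add, LinearMap.add_apply, hc, hc']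
  | single I a => simp only [Finsupp.smul_single, formalAdjoint_single, smul_eq_mul]; ring_nf

theorem formalAdjoint_Dx_comp (i : Fin n) (c : (Fin n → ℕ) →₀ R) (g : R) :
    𝓐.formalAdjoint (Finsupp.mapRange.linearMap (𝓐.Dx i : Module.End 𝕜 R) c +
      c.mapDomain (· + Pi.single i 1)) g = -𝓐.formalAdjoint c (𝓐.Dx i g) := by
  induction c using Finsupp.induction_linear with
  | zero => simp
  | add c c' hc hc' =>
    rw [(Finsupp.mapRange.linearMap _).map_add, Finsupp.mapDomain_add, add_add_add_comm, map_add,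
      LinearMap.add_apply, hc, hc', map_add, LinearMap.add_apply, neg_add]
  | single I a =>
    rw [Finsupp.mapRange.linearMap_apply, Finsupp.mapRange_single, Finsupp.mapDomain_single,
      map_add, LinearMap.add_apply]
    simp only [formalAdjoint_single, len_add, len_single, ← DxPow_Dx, Derivation.leibniz,
      smul_eq_mul, map_add, Derivation.coeFn_coe, pow_succ, mul_neg_one, neg_smul, smul_add,
      mul_comm g]
    abel

theorem formalAdjoint_mapRange {D : Derivation 𝕜 R R}
    (hD : ∀ I f, D (𝓐.DxPow I f) = 𝓐.DxPow I (D f)) (c : (Fin n → ℕ) →₀ R) (g : R) :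
    𝓐.formalAdjoint (Finsupp.mapRange.linearMap (D : Module.End 𝕜 R) c) g =
      D (𝓐.formalAdjoint c g) - 𝓐.formalAdjoint c (D g) := by
  induction c using Finsupp.induction_linear with
  | zero => simp
  | add c c' hc hc' => simp only [map_add, LinearMap.add_apply, hc, hc']; abel
  | single I a =>
    simp only [Finsupp.mapRange.linearMap_apply, Finsupp.mapRange_single, formalAdjoint_single,
      Derivation.map_smul, hD, Derivation.leibniz, smul_eq_mul, map_add, Derivation.coeFn_coe,
      smul_add, mul_comm g]
    abel

/-- The coefficients `∂f/∂u_{s,I}` of the part of the linearization of `f` that acts on the `s`-th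
time derivative. -/
def linearization (s : Fin h) : Derivation 𝕜 R ((Fin n → ℕ) →₀ R) :=
  .mk'
    { toFun := fun f => .ofSupportFinite (fun I => 𝓐.du s I f)
        ((𝓐.finite_der f).preimage fun _ _ _ _ hIJ => (JetVar.u.inj hIJ).2)
      map_add' := fun f g => Finsupp.ext fun I => map_add (𝓐.du s I) f g
      map_smul' := fun c f => Finsupp.ext fun I => (𝓐.du s I).map_smul c f }
    fun f g => Finsupp.ext fun I => (𝓐.du s I).leibniz f g

theorem linearization_apply (s : Fin h) (f : R) (I : Fin n → ℕ) :
    𝓐.linearization s f I = 𝓐.du s I f := rfl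

theorem linearization_Dx (s : Fin h) (i : Fin n) (f : R) : 𝓐.linearization s (𝓐.Dx i f) =
    Finsupp.mapRange.linearMap (𝓐.Dx i : Module.End 𝕜 R) (𝓐.linearization s f) +
      (𝓐.linearization s f).mapDomain (· + Pi.single i 1) := by
  ext I
  simp only [Finsupp.add_apply, Finsupp.mapRange.linearMap_apply, Finsupp.mapRange_apply,
    linearization_apply, Derivation.coeFn_coe]
  by_cases hI : I i = 0
  · rw [du_Dx_of_eq_zero _ hI, Finsupp.mapDomain_of_notMem_range, add_zero]
    rintro ⟨J, rfl⟩
    simp at hI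
  · obtain ⟨J, rfl⟩ := exists_eq_add_single hI
    rw [du_add_single_Dx, Finsupp.mapDomain_apply (add_left_injective _), linearization_apply]

/-- The formal adjoint of the part of the linearization of `f` that acts on the `s`-th time
derivative. -/
def adjoint (s : Fin h) (f : R) : Module.End 𝕜 R := 𝓐.formalAdjoint (𝓐.linearization s f)

theorem adjoint_Dx (s : Fin h) (i : Fin n) (f g : R) :
    𝓐.adjoint s (𝓐.Dx i f) g = -𝓐.adjoint s f (𝓐.Dx i g) := by
  rw [adjoint, linearization_Dx, formalAdjoint_Dx_comp, adjoint]

theorem adjoint_DxPow (s : Fin h) (I : Fin n → ℕ) (f g : R) :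
    𝓐.adjoint s (𝓐.DxPow I f) g = (-1 : 𝕜) ^ len I • 𝓐.adjoint s f (𝓐.DxPow I g) := by
  induction I using multiIndex_induction generalizing g with
  | zero => simp [DxPow_zero_apply, len]
  | add_single I i ih =>
    rw [DxPow_add_single_apply, adjoint_Dx, ih, DxPow_Dx, len_add, len_single, pow_succ,
      mul_neg_one, neg_smul]

end FormalAdjoint

section Evolution

variable {𝕜 R : Type*} [CommRing 𝕜] [CommRing R] [Algebra 𝕜 R] {n m : ℕ}
  (𝓐 : CoordAlgebra 𝕜 (JetVar n (m + 1)) R) (F : R)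

theorem linearization_Dt (s : Fin (m + 1)) (f : R) : 𝓐.linearization s (𝓐.Dt F f) =
    Finsupp.mapRange.linearMap (𝓐.Dt F : Module.End 𝕜 R) (𝓐.linearization s f) +
      Fin.cases (motive := fun _ => (Fin n → ℕ) →₀ R) 0
        (fun s => 𝓐.linearization s.castSucc f) s +
      (𝓐.linearization (Fin.last m) f).sum fun J b => b • 𝓐.linearization s (𝓐.DxPow J F) := by
  ext I
  have hsum : ((𝓐.linearization (Fin.last m) f).sum fun J b =>
      b • 𝓐.linearization s (𝓐.DxPow J F)) I =
        ∑ᶠ J, 𝓐.du s I (𝓐.DxPow J F) * 𝓐.du (Fin.last m) J f := by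
    rw [Finsupp.sum_apply, Finsupp.sum, finsum_eq_sum_of_support_subset
      (s := (𝓐.linearization (Fin.last m) f).support)]
    · simp [linearization_apply, mul_comm]
    · exact fun J hJ => Finsupp.mem_support_iff.2 (right_ne_zero_of_mul hJ)
  rw [Finsupp.add_apply, hsum, linearization_apply, du_Dt]
  cases s using Fin.cases <;> simp [linearization_apply]

theorem adjoint_Dt (s : Fin (m + 1)) (f g : R) : 𝓐.adjoint s (𝓐.Dt F f) g =
    𝓐.Dt F (𝓐.adjoint s f g) - 𝓐.adjoint s f (𝓐.Dt F g) +
      Fin.cases (motive := fun _ => R) 0 (fun s => 𝓐.adjoint s.castSucc f g) s +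
      𝓐.adjoint s F (𝓐.adjoint (Fin.last m) f g) := by
  have hsum : 𝓐.formalAdjoint ((𝓐.linearization (Fin.last m) f).sum fun J b =>
      b • 𝓐.linearization s (𝓐.DxPow J F)) g = 𝓐.adjoint s F (𝓐.adjoint (Fin.last m) f g) := by
    rw [adjoint, adjoint, 𝓐.formalAdjoint_apply (𝓐.linearization (Fin.last m) f), Finsupp.sum,
      map_sum, LinearMap.sum_apply, Finsupp.sum, map_sum]
    refine Finset.sum_congr rfl fun J _ => ?_
    rw [formalAdjoint_smul, ← adjoint, adjoint_DxPow, LinearMap.map_smul, adjoint]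
  rw [adjoint, linearization_Dt, map_add, map_add, LinearMap.add_apply, LinearMap.add_apply, hsum,
    formalAdjoint_mapRange _ (𝓐.Dt_DxPow F)]
  cases s using Fin.cases <;> simp [adjoint]

/-- Applying the adjoint linearizations to the conservation law `D_t f + ∑ D_{x_i} J_i = 0` gives a
recursion for `p_s = adjoint s f 1`, whose elimination is the equation for the characteristic. -/
theorem DtPow_adjoint_last {f : R} {J : Fin n → R} (hJ : 𝓐.Dt F f + ∑ i, 𝓐.Dx i (J i) = 0) :
    (-1 : 𝕜) ^ (m + 1) • 𝓐.DtPow F (m + 1) (𝓐.adjoint (Fin.last m) f 1) =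
      ∑ s : Fin (m + 1), (-1 : 𝕜) ^ (s : ℕ) •
        𝓐.DtPow F s (𝓐.adjoint s F (𝓐.adjoint (Fin.last m) f 1)) := by
  have hDt : ∀ s, 𝓐.adjoint s (𝓐.Dt F f) 1 = 0 := fun s => by
    have hDx : ∀ i, 𝓐.formalAdjoint (𝓐.linearization s (𝓐.Dx i (J i))) 1 = 0 := fun i => by
      rw [← adjoint, adjoint_Dx, Derivation.map_one_eq_zero, map_zero, neg_zero]
    rw [eq_neg_of_add_eq_zero_left hJ, adjoint, map_neg, map_sum, map_neg, map_sum,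
      LinearMap.neg_apply, LinearMap.sum_apply, Finset.sum_eq_zero fun i _ => hDx i, neg_zero]
  simp only [adjoint_Dt, Derivation.map_one_eq_zero, map_zero, sub_zero] at hDt
  refine neg_one_pow_smul_pow_last_eq_sum (𝓐.Dt F : Module.End 𝕜 R)
    (fun s => 𝓐.adjoint s f 1) _ ?_ fun s => ?_
  · simpa using hDt 0
  · simpa using hDt s.succ

end Evolution

section NormalForm

variable {𝕜 R : Type*} [CommRing 𝕜] [CommRing R] [Algebra 𝕜 R] {n h : ℕ}
  (𝓐 : CoordAlgebra 𝕜 (JetVar n h) R) {c : (Fin n → ℕ) →₀ R}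

/-- The coefficient of `D_x^K` in the normal form of the formal adjoint of `∑_I c_I D_x^I`. -/
def adjointCoeff (c : (Fin n → ℕ) →₀ R) (K : Fin n → ℕ) : R :=
  c.sum fun I a => (-1 : 𝕜) ^ len I • multiChoose I K • 𝓐.DxPow (I - K) a

theorem formalAdjoint_eq_sum {S : Finset (Fin n → ℕ)} (hS : ∀ I ∈ c.support, Finset.Iic I ⊆ S)
    (g : R) : 𝓐.formalAdjoint c g = ∑ K ∈ S, 𝓐.adjointCoeff c K * 𝓐.DxPow K g := by
  simp only [adjointCoeff, Finsupp.sum, Finset.sum_mul]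
  rw [formalAdjoint_apply, Finsupp.sum, Finset.sum_comm]
  refine Finset.sum_congr rfl fun I hI => ?_
  rw [DxPow_mul, Finset.smul_sum]
  refine (Finset.sum_congr rfl fun K _ => ?_).trans (Finset.sum_subset (hS I hI) fun K _ hK => ?_)
  · rw [smul_mul_assoc, smul_mul_assoc]
  · rw [multiChoose_eq_zero (by simpa using hK), zero_smul, smul_zero, zero_mul]

theorem adjointCoeff_of_len_eq {N : ℕ} (hc : ∀ I, N < len I → c I = 0) {K : Fin n → ℕ}
    (hK : len K = N) : 𝓐.adjointCoeff c K = (-1 : 𝕜) ^ N • c K := by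
  rw [adjointCoeff, Finsupp.sum, Finset.sum_eq_single K]
  · rw [multiChoose_self, one_smul, tsub_self, DxPow_zero_apply, hK]
  · intro I hI hIK
    have hKI : ¬K ≤ I := fun hle => hIK <| (eq_of_le_of_len_le hle <|
      not_lt.1 fun hlt => Finsupp.mem_support_iff.1 hI (hc I (hK ▸ hlt))).symm
    rw [multiChoose_eq_zero hKI, zero_smul, smul_zero]
  · intro hKc
    rw [Finsupp.notMem_support_iff.1 hKc, map_zero, smul_zero, smul_zero]

end NormalForm

section Evolution

variable {𝕜 R : Type*} [CommRing 𝕜] [CommRing R] [Algebra 𝕜 R] {n m : ℕ}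
  (𝓐 : CoordAlgebra 𝕜 (JetVar n (m + 1)) R) (F : R)

/-- The coefficient of `D_t^s` in the normal form of `∑_{1 ≤ r ≤ m} (-1)^r D_t^r ∘ ∂F/∂u_{r,0}`. -/
def timeCoeff (s : ℕ) : R :=
  ∑ r ∈ Finset.univ.filter (fun r : Fin (m + 1) => 1 ≤ (r : ℕ)),
    (-1 : 𝕜) ^ (r : ℕ) • (r : ℕ).choose s • 𝓐.DtPow F (r - s) (𝓐.du r 0 F)

/-- The coefficient of `D_x^K` in the normal form of the adjoint linearization of `F`. -/
def spaceCoeff (K : Fin n → ℕ) : R :=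
  𝓐.adjointCoeff (𝓐.linearization 0 F) K + if K = 0 then 𝓐.timeCoeff F 0 else 0

theorem sum_DtPow_mul (g : R) : ∑ r ∈ Finset.univ.filter (fun r : Fin (m + 1) => 1 ≤ (r : ℕ)),
      (-1 : 𝕜) ^ (r : ℕ) • 𝓐.DtPow F r (𝓐.du r 0 F * g) =
    ∑ s ∈ Finset.range m, 𝓐.timeCoeff F (s + 1) * 𝓐.DtPow F (s + 1) g + 𝓐.timeCoeff F 0 * g := by
  have hrange := Finset.sum_range_succ' (fun s => 𝓐.timeCoeff F s * 𝓐.DtPow F s g) m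
  rw [DtPow_zero_apply] at hrange
  rw [← hrange]
  simp only [timeCoeff, Finset.sum_mul]
  rw [Finset.sum_comm]
  refine Finset.sum_congr rfl fun r _ => ?_
  rw [DtPow_mul, Finset.smul_sum]
  refine (Finset.sum_congr rfl fun s _ => ?_).trans
    (Finset.sum_subset (Finset.range_subset_range.2 r.isLt) fun s _ hs => ?_)
  · rw [smul_mul_assoc, smul_mul_assoc]
  · rw [Nat.choose_eq_zero_of_lt (by simpa using hs), zero_smul, smul_zero, zero_mul]

variable {F}

theorem adjoint_eq_mul {s : Fin (m + 1)} (hF : ∀ I, I ≠ 0 → 𝓐.du s I F = 0) (g : R) :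
    𝓐.adjoint s F g = 𝓐.du s 0 F * g := by
  have hlin : 𝓐.linearization s F = .single 0 (𝓐.du s 0 F) := by
    ext I
    rcases eq_or_ne I 0 with rfl | hI
    · rw [linearization_apply, Finsupp.single_eq_same]
    · rw [linearization_apply, hF I hI, Finsupp.single_eq_of_ne hI]
  rw [adjoint, hlin, formalAdjoint_single, DxPow_zero_apply, len_eq_zero.2 rfl, pow_zero, one_smul]

theorem sum_DtPow_adjoint (hF : ∀ s I, s ≠ 0 → I ≠ 0 → 𝓐.du s I F = 0) {N : ℕ}
    (hN : 𝓐.RowOrderLE 0 N F) (g : R) :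
    ∑ s : Fin (m + 1), (-1 : 𝕜) ^ (s : ℕ) • 𝓐.DtPow F s (𝓐.adjoint s F g) =
      ∑ K ∈ lenLE N, 𝓐.spaceCoeff F K * 𝓐.DxPow K g +
        ∑ s ∈ Finset.range m, 𝓐.timeCoeff F (s + 1) * 𝓐.DtPow F (s + 1) g := by
  have hzero : 𝓐.adjoint 0 F g =
      ∑ K ∈ lenLE N, 𝓐.adjointCoeff (𝓐.linearization 0 F) K * 𝓐.DxPow K g := by
    refine 𝓐.formalAdjoint_eq_sum (fun I hI K hK => mem_lenLE.2 ?_) g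
    exact (len_mono (Finset.mem_Iic.1 hK)).trans <|
      not_lt.1 fun hlt => Finsupp.mem_support_iff.1 hI (hN I hlt)
  have hpos : ∑ s : Fin m, (-1 : 𝕜) ^ (s.succ : ℕ) • 𝓐.DtPow F s.succ (𝓐.adjoint s.succ F g) =
      ∑ r ∈ Finset.univ.filter (fun r : Fin (m + 1) => 1 ≤ (r : ℕ)),
        (-1 : 𝕜) ^ (r : ℕ) • 𝓐.DtPow F r (𝓐.du r 0 F * g) := by
    rw [Finset.sum_filter, Fin.sum_univ_succ]
    simp [𝓐.adjoint_eq_mul (hF _ · (Fin.succ_ne_zero _))]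
  rw [Fin.sum_univ_succ, hpos, sum_DtPow_mul, hzero]
  simp only [spaceCoeff, add_mul, Finset.sum_add_distrib, ite_mul, zero_mul]
  rw [Finset.sum_ite_eq' (lenLE N) 0, if_pos (mem_lenLE.2 (by simp [len])), DxPow_zero_apply,
    Fin.val_zero, pow_zero, one_smul, DtPow_zero_apply]
  abel

theorem spaceCoeff_of_len_eq {N : ℕ} (hN : 0 < N) (hF : 𝓐.RowOrderLE 0 N F) {K : Fin n → ℕ}
    (hK : len K = N) : 𝓐.spaceCoeff F K = (-1 : 𝕜) ^ N • 𝓐.du 0 K F := by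
  have hK0 : K ≠ 0 := fun h0 => hN.ne' (hK ▸ len_eq_zero.2 h0)
  rw [spaceCoeff, if_neg hK0, add_zero, 𝓐.adjointCoeff_of_len_eq (fun I => hF I) hK,
    linearization_apply]

end Evolution

end CoordAlgebra

section HomogeneousPart

variable {R : Type*} [CommRing R] {n : ℕ}

/-- The homogeneous polynomial `∑_{|I| = k} c_I q^I`. -/
def homogeneousPart (k : ℕ) : ((Fin n → ℕ) →₀ R) →ₗ[R] AddMonoidAlgebra R (Fin n → ℕ) :=
  Finsupp.lsum R fun I => if len I = k then AddMonoidAlgebra.lsingle I else 0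

theorem homogeneousPart_single (k : ℕ) (I : Fin n → ℕ) (a : R) :
    homogeneousPart k (.single I a) = if len I = k then AddMonoidAlgebra.single I a else 0 := by
  by_cases hI : len I = k <;> simp [homogeneousPart, hI]

theorem homogeneousPart_eq_sum {S : Finset (Fin n → ℕ)} {c : (Fin n → ℕ) →₀ R}
    (hS : c.support ⊆ S) (k : ℕ) : homogeneousPart k c =
      ∑ I ∈ S, if len I = k then AddMonoidAlgebra.single I (c I) else 0 := by
  conv_lhs => rw [← c.sum_single, Finsupp.sum_of_support_subset c hS _ (by simp), map_sum]
  exact Finset.sum_congr rfl fun I _ => homogeneousPart_single k I (c I)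

theorem coeff_homogeneousPart (k : ℕ) (c : (Fin n → ℕ) →₀ R) (I : Fin n → ℕ) :
    (homogeneousPart k c).coeff I = if len I = k then c I else 0 := by
  induction c using Finsupp.induction_linear with
  | zero => simp
  | add c c' hc hc' =>
    rw [map_add, AddMonoidAlgebra.coeff_add, Finsupp.add_apply, hc, hc', Finsupp.add_apply,
      ← ite_add_zero]
  | single J a =>
    rw [homogeneousPart_single]
    by_cases hIJ : J = I
    · subst hIJ
      split_ifs <;> simp
    · split_ifs <;> simp [hIJ]

theorem homogeneousPart_mapRange (D : R →+ R) (k : ℕ) (c : (Fin n → ℕ) →₀ R) :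
    homogeneousPart k (c.mapRange D D.map_zero) = (homogeneousPart k c).map D := by
  ext I
  by_cases hI : len I = k <;> simp [coeff_homogeneousPart, hI]

theorem homogeneousPart_mapDomain (i : Fin n) (k : ℕ) (c : (Fin n → ℕ) →₀ R) :
    homogeneousPart (k + 1) (c.mapDomain (· + Pi.single i 1)) =
      AddMonoidAlgebra.single (Pi.single i 1) 1 * homogeneousPart k c := by
  induction c using Finsupp.induction_linear with
  | zero => simp
  | add c c' hc hc' => rw [Finsupp.mapDomain_add, map_add, hc, hc', map_add, mul_add]
  | single I a =>
    rw [Finsupp.mapDomain_single, homogeneousPart_single, homogeneousPart_single, len_add,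
      len_single]
    by_cases hI : len I = k <;> simp [hI, AddMonoidAlgebra.single_mul_single, add_comm]

end HomogeneousPart

namespace CoordAlgebra

section Symbol

variable {𝕜 R : Type*} [CommRing 𝕜] [CommRing R] [Algebra 𝕜 R] {n h : ℕ}
  (𝓐 : CoordAlgebra 𝕜 (JetVar n h) R) {s : Fin h} {k l : ℕ} {f : R}

/-- The symbol `∑_{|I| = k} ∂f/∂u_{s,I} q^I`. -/
def symbol (s : Fin h) (k : ℕ) : Derivation 𝕜 R (AddMonoidAlgebra R (Fin n → ℕ)) :=
  (homogeneousPart k).compDer (𝓐.linearization s)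

theorem symbol_apply (s : Fin h) (k : ℕ) (f : R) :
    𝓐.symbol s k f = homogeneousPart k (𝓐.linearization s f) := rfl

theorem coeff_symbol (s : Fin h) (k : ℕ) (f : R) (I : Fin n → ℕ) :
    (𝓐.symbol s k f).coeff I = if len I = k then 𝓐.du s I f else 0 :=
  coeff_homogeneousPart k _ I

theorem rowOrderLE_iff_symbol : 𝓐.RowOrderLE s k f ↔ ∀ l, k < l → 𝓐.symbol s l f = 0 := by
  refine ⟨fun hf l hl => ?_, fun hf I hI => ?_⟩
  · ext I
    rw [coeff_symbol]
    split_ifs with hI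
    · exact hf I (hI ▸ hl)
    · rfl
  · simpa [coeff_symbol] using congrArg (fun p => p.coeff I) (hf _ hI)

variable {𝓐}

theorem RowOrderLE.symbol_eq_zero (hf : 𝓐.RowOrderLE s k f) (hkl : k < l) : 𝓐.symbol s l f = 0 :=
  𝓐.rowOrderLE_iff_symbol.1 hf l hkl

theorem RowOrderLE.mono (hf : 𝓐.RowOrderLE s k f) (hkl : k ≤ l) : 𝓐.RowOrderLE s l f :=
  fun I hI => hf I (hkl.trans_lt hI)

variable (𝓐)

theorem symbol_Dx (s : Fin h) (k : ℕ) (i : Fin n) (f : R) : 𝓐.symbol s (k + 1) (𝓐.Dx i f) =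
    (𝓐.symbol s (k + 1) f).map (𝓐.Dx i : Module.End 𝕜 R).toAddMonoidHom +
      .single (Pi.single i 1) 1 * 𝓐.symbol s k f := by
  rw [symbol_apply, linearization_Dx, map_add, homogeneousPart_mapDomain]
  congr 1
  exact homogeneousPart_mapRange (𝓐.Dx i : Module.End 𝕜 R).toAddMonoidHom _ _

variable {𝓐}

theorem RowOrderLE.symbol_Dx (hf : 𝓐.RowOrderLE s k f) (i : Fin n) :
    𝓐.symbol s (k + 1) (𝓐.Dx i f) = .single (Pi.single i 1) 1 * 𝓐.symbol s k f := by
  rw [CoordAlgebra.symbol_Dx, hf.symbol_eq_zero k.lt_succ_self, AddMonoidAlgebra.map_zero, zero_add]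

theorem RowOrderLE.dx (hf : 𝓐.RowOrderLE s k f) (i : Fin n) :
    𝓐.RowOrderLE s (k + 1) (𝓐.Dx i f) := by
  refine 𝓐.rowOrderLE_iff_symbol.2 fun l hl => ?_
  obtain ⟨l, rfl⟩ : ∃ l', l = l' + 1 := ⟨l - 1, by omega⟩
  rw [(hf.mono (by omega : k ≤ l)).symbol_Dx, hf.symbol_eq_zero (by omega), mul_zero]

theorem RowOrderLE.dxPow (hf : 𝓐.RowOrderLE s k f) (J : Fin n → ℕ) :
    𝓐.RowOrderLE s (k + len J) (𝓐.DxPow J f) := by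
  induction J using multiIndex_induction with
  | zero => rwa [len_eq_zero.2 rfl, DxPow_zero_apply, add_zero]
  | add_single J i ih =>
    rw [DxPow_add_single_apply, len_add, len_single, ← add_assoc]
    exact ih.dx i

theorem RowOrderLE.symbol_DxPow (hf : 𝓐.RowOrderLE s k f) (J : Fin n → ℕ) :
    𝓐.symbol s (k + len J) (𝓐.DxPow J f) = .single J 1 * 𝓐.symbol s k f := by
  induction J using multiIndex_induction with
  | zero => rw [len_eq_zero.2 rfl, DxPow_zero_apply, add_zero, ← AddMonoidAlgebra.one_def, one_mul]
  | add_single J i ih =>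
    rw [DxPow_add_single_apply, len_add, len_single, ← add_assoc, (hf.dxPow J).symbol_Dx, ih,
      ← mul_assoc, AddMonoidAlgebra.single_mul_single, mul_one, add_comm J]

end Symbol

section EvolutionSymbol

variable {𝕜 R : Type*} [CommRing 𝕜] [CommRing R] [Algebra 𝕜 R] {n m : ℕ}
  {𝓐 : CoordAlgebra 𝕜 (JetVar n (m + 1)) R} {F f : R}

theorem homogeneousPart_sum_linearization_DxPow {s : Fin (m + 1)} {a b : ℕ}
    (hF : 𝓐.RowOrderLE s a F) {c : (Fin n → ℕ) →₀ R} (hc : ∀ J, b < len J → c J = 0) :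
    homogeneousPart (a + b) (c.sum fun J r => r • 𝓐.linearization s (𝓐.DxPow J F)) =
      𝓐.symbol s a F * homogeneousPart b c := by
  rw [homogeneousPart_eq_sum subset_rfl b, Finsupp.sum, map_sum, Finset.mul_sum]
  refine Finset.sum_congr rfl fun J hJ => ?_
  rw [map_smul, ← symbol_apply]
  rcases (not_lt.1 fun hlt => Finsupp.mem_support_iff.1 hJ (hc J hlt)).lt_or_eq with hlt | rfl
  · rw [(hF.dxPow J).symbol_eq_zero (Nat.add_lt_add_left hlt a), smul_zero, if_neg hlt.ne, mul_zero]
  · rw [hF.symbol_DxPow, if_pos rfl, ← smul_mul_assoc, AddMonoidAlgebra.smul_single', mul_one,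
      mul_comm]

theorem symbol_Dt {s : Fin (m + 1)} {a b l : ℕ} (hF : 𝓐.RowOrderLE s a F)
    (hf : 𝓐.RowOrderLE (Fin.last m) b f) (hab : a + b = l) : 𝓐.symbol s l (𝓐.Dt F f) =
      (𝓐.symbol s l f).map (𝓐.Dt F : Module.End 𝕜 R).toAddMonoidHom +
        Fin.cases (motive := fun _ => AddMonoidAlgebra R (Fin n → ℕ)) 0
          (fun s => 𝓐.symbol s.castSucc l f) s +
        𝓐.symbol s a F * 𝓐.symbol (Fin.last m) b f := by
  subst hab
  rw [symbol_apply, linearization_Dt, map_add, map_add,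
    homogeneousPart_sum_linearization_DxPow hF fun J => hf J]
  congr 2
  · exact homogeneousPart_mapRange (𝓐.Dt F : Module.End 𝕜 R).toAddMonoidHom _ _
  · cases s using Fin.cases with
    | zero => exact map_zero _
    | succ s => rfl

theorem RowOrderLE.dt {s : Fin (m + 1)} {a b l : ℕ} (hF : 𝓐.RowOrderLE s a F)
    (hlast : 𝓐.RowOrderLE (Fin.last m) b f) (hab : a + b ≤ l) (hf : 𝓐.RowOrderLE s l f)
    (hpred : ∀ s' : Fin m, s'.succ = s → 𝓐.RowOrderLE s'.castSucc l f) :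
    𝓐.RowOrderLE s l (𝓐.Dt F f) := by
  refine 𝓐.rowOrderLE_iff_symbol.2 fun l' hl' => ?_
  obtain ⟨a', rfl⟩ : ∃ a', l' = a' + b := ⟨l' - b, by omega⟩
  rw [symbol_Dt (hF.mono (by omega : a ≤ a')) hlast rfl, hf.symbol_eq_zero hl',
    hF.symbol_eq_zero (by omega), AddMonoidAlgebra.map_zero, zero_mul, zero_add, add_zero]
  cases s using Fin.cases with
  | zero => rfl
  | succ s => exact (hpred s rfl).symbol_eq_zero hl'

variable {N k : ℕ} {χ : R}

theorem rowOrderLE_DtPow (hF₀ : 𝓐.RowOrderLE 0 N F) (hF : ∀ s ≠ 0, 𝓐.RowOrderLE s 0 F)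
    (hχ : ∀ s, 𝓐.RowOrderLE s k χ) {j : ℕ} (hj : j ≤ m + 1) (s : Fin (m + 1)) :
    𝓐.RowOrderLE s (if (s : ℕ) < j then k + N else k) (𝓐.DtPow F j χ) := by
  induction j generalizing s with
  | zero => exact hχ s
  | succ j ih =>
    have hlast : 𝓐.RowOrderLE (Fin.last m) k (𝓐.DtPow F j χ) := by
      simpa [(Nat.succ_le_succ_iff.1 hj).not_gt] using ih (by omega) (Fin.last m)
    have hs : 𝓐.RowOrderLE s (if (s : ℕ) < j + 1 then k + N else k) (𝓐.DtPow F j χ) :=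
      (ih (by omega) s).mono (by grind)
    rw [DtPow_succ_apply]
    cases s using Fin.cases with
    | zero => exact hF₀.dt hlast (by grind) hs fun s' hs' => absurd hs' (Fin.succ_ne_zero s')
    | succ s =>
      refine (hF _ (Fin.succ_ne_zero s)).dt hlast (by grind) hs fun s' hs' => ?_
      rw [Fin.succ_inj.1 hs']
      simpa using ih (by omega) s.castSucc

theorem rowOrderLE_last_DtPow (hF₀ : 𝓐.RowOrderLE 0 N F) (hF : ∀ s ≠ 0, 𝓐.RowOrderLE s 0 F)
    (hχ : ∀ s, 𝓐.RowOrderLE s k χ) {j : ℕ} (hj : j ≤ m) :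
    𝓐.RowOrderLE (Fin.last m) k (𝓐.DtPow F j χ) := by
  simpa [hj.not_gt] using rowOrderLE_DtPow hF₀ hF hχ (hj.trans m.le_succ) (Fin.last m)

variable {c : Fin (m + 1)}

theorem symbol_DtPow_of_add_le (hF₀ : 𝓐.RowOrderLE 0 N F) (hF : ∀ s ≠ 0, 𝓐.RowOrderLE s 0 F)
    (hχ : ∀ s, 𝓐.RowOrderLE s k χ) (hc : ∀ s > c, 𝓐.symbol s k χ = 0) {j : ℕ}
    (hj : c + j ≤ m) {s : Fin (m + 1)} (hs : c + j ≤ (s : ℕ)) :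
    𝓐.symbol s k (𝓐.DtPow F j χ) = if (s : ℕ) = c + j then 𝓐.symbol c k χ else 0 := by
  induction j generalizing s with
  | zero =>
    split_ifs with h
    · rw [Fin.ext h, DtPow_zero_apply]
    · exact hc s (by omega)
  | succ j ih =>
    cases s using Fin.cases with
    | zero => simp at hs
    | succ s =>
      rw [Fin.val_succ] at hs ⊢
      have hself : 𝓐.symbol s.succ k (𝓐.DtPow F j χ) = 0 := by
        rw [ih (by omega) (by rw [Fin.val_succ]; omega), if_neg (by rw [Fin.val_succ]; omega)]
      have hlast : 𝓐.symbol (Fin.last m) k (𝓐.DtPow F j χ) = 0 := by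
        rw [ih (by omega) (by rw [Fin.val_last]; omega), if_neg (by rw [Fin.val_last]; omega)]
      rw [DtPow_succ_apply, symbol_Dt (hF _ (Fin.succ_ne_zero s))
        (rowOrderLE_last_DtPow hF₀ hF hχ (by omega)) (zero_add k), hself, hlast, mul_zero, add_zero,
        AddMonoidAlgebra.map_zero, zero_add, Fin.cases_succ, ih (by omega)
        (by simpa using by omega)]
      simp [← add_assoc]

theorem symbol_succ_DtPow_succ (hN : 0 < N) (hF₀ : 𝓐.RowOrderLE 0 N F)
    (hF : ∀ s ≠ 0, 𝓐.RowOrderLE s 0 F) (hχ : ∀ s, 𝓐.RowOrderLE s k χ) {j : ℕ} (hj : j ≤ m)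
    (s : Fin m) : 𝓐.symbol s.succ (k + N) (𝓐.DtPow F (j + 1) χ) =
      (𝓐.symbol s.succ (k + N) (𝓐.DtPow F j χ)).map (𝓐.Dt F : Module.End 𝕜 R).toAddMonoidHom +
        𝓐.symbol s.castSucc (k + N) (𝓐.DtPow F j χ) := by
  have hFs := hF _ (Fin.succ_ne_zero s)
  rw [DtPow_succ_apply, symbol_Dt (hFs.mono N.zero_le) (rowOrderLE_last_DtPow hF₀ hF hχ hj)
    (add_comm N k), hFs.symbol_eq_zero hN, zero_mul, add_zero, Fin.cases_succ]

theorem symbol_zero_DtPow_succ (hF₀ : 𝓐.RowOrderLE 0 N F)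
    (hF : ∀ s ≠ 0, 𝓐.RowOrderLE s 0 F) (hχ : ∀ s, 𝓐.RowOrderLE s k χ) {j : ℕ} (hj : j ≤ m) :
    𝓐.symbol 0 (k + N) (𝓐.DtPow F (j + 1) χ) =
      (𝓐.symbol 0 (k + N) (𝓐.DtPow F j χ)).map (𝓐.Dt F : Module.End 𝕜 R).toAddMonoidHom +
        𝓐.symbol 0 N F * 𝓐.symbol (Fin.last m) k (𝓐.DtPow F j χ) := by
  rw [DtPow_succ_apply, symbol_Dt hF₀ (rowOrderLE_last_DtPow hF₀ hF hχ hj) (add_comm N k),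
    Fin.cases_zero, add_zero]

theorem symbol_DtPow_eq_zero (hN : 0 < N) (hF₀ : 𝓐.RowOrderLE 0 N F)
    (hF : ∀ s ≠ 0, 𝓐.RowOrderLE s 0 F) (hχ : ∀ s, 𝓐.RowOrderLE s k χ)
    (hc : ∀ s > c, 𝓐.symbol s k χ = 0) {j : ℕ} (hj : c + j ≤ m) (s : Fin (m + 1)) :
    𝓐.symbol s (k + N) (𝓐.DtPow F j χ) = 0 := by
  induction j generalizing s with
  | zero => exact (hχ s).symbol_eq_zero (by omega)
  | succ j ih =>
    cases s using Fin.cases with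
    | zero =>
      have hlast : 𝓐.symbol (Fin.last m) k (𝓐.DtPow F j χ) = 0 := by
        rw [symbol_DtPow_of_add_le hF₀ hF hχ hc (by omega) (by rw [Fin.val_last]; omega),
          if_neg (by rw [Fin.val_last]; omega)]
      rw [symbol_zero_DtPow_succ hF₀ hF hχ (by omega), ih (by omega), hlast, mul_zero, add_zero,
        AddMonoidAlgebra.map_zero]
    | succ s =>
      rw [symbol_succ_DtPow_succ hN hF₀ hF hχ (by omega), ih (by omega), ih (by omega),
        AddMonoidAlgebra.map_zero, add_zero]

theorem symbol_DtPow_of_lt_add (hN : 0 < N) (hF₀ : 𝓐.RowOrderLE 0 N F)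
    (hF : ∀ s ≠ 0, 𝓐.RowOrderLE s 0 F) (hχ : ∀ s, 𝓐.RowOrderLE s k χ)
    (hc : ∀ s > c, 𝓐.symbol s k χ = 0) {j i : ℕ} (hj : c + j = m + 1 + i) (hi : i ≤ c)
    {s : Fin (m + 1)} (hs : i ≤ (s : ℕ)) :
    𝓐.symbol s (k + N) (𝓐.DtPow F j χ) =
      if (s : ℕ) = i then 𝓐.symbol 0 N F * 𝓐.symbol c k χ else 0 := by
  obtain ⟨j, rfl⟩ : ∃ j', j = j' + 1 := ⟨j - 1, by omega⟩
  induction i generalizing j s with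
  | zero =>
    have hzero := symbol_DtPow_eq_zero hN hF₀ hF hχ hc (j := j) (by omega)
    cases s using Fin.cases with
    | zero =>
      rw [symbol_zero_DtPow_succ hF₀ hF hχ (by omega), hzero, AddMonoidAlgebra.map_zero, zero_add,
        symbol_DtPow_of_add_le hF₀ hF hχ hc (by omega) (by rw [Fin.val_last]; omega),
        if_pos (by rw [Fin.val_last]; omega), if_pos (Fin.val_zero _)]
    | succ s =>
      rw [symbol_succ_DtPow_succ hN hF₀ hF hχ (by omega), hzero, hzero, AddMonoidAlgebra.map_zero,
        add_zero, if_neg (by simp)]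
  | succ i ih =>
    obtain ⟨j, rfl⟩ : ∃ j', j = j' + 1 := ⟨j - 1, by omega⟩
    cases s using Fin.cases with
    | zero => simp at hs
    | succ s =>
      rw [Fin.val_succ] at hs ⊢
      rw [symbol_succ_DtPow_succ hN hF₀ hF hχ (by omega),
        ih (by omega) (by rw [Fin.val_succ]; omega) j (by omega),
        if_neg (by rw [Fin.val_succ]; omega), AddMonoidAlgebra.map_zero, zero_add,
        ih (by omega) (by simpa using by omega) j (by omega)]
      simp

theorem symbol_mul_DtPow_of_lt (hN : 0 < N) (hF₀ : 𝓐.RowOrderLE 0 N F)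
    (hF : ∀ s ≠ 0, 𝓐.RowOrderLE s 0 F) (hχ : ∀ s, 𝓐.RowOrderLE s k χ)
    (hc : ∀ s > c, 𝓐.symbol s k χ = 0) {g : R} (hg : 𝓐.symbol c (k + N) g = 0) {j : ℕ}
    (hj : j ≤ m) : 𝓐.symbol c (k + N) (g * 𝓐.DtPow F j χ) = 0 := by
  suffices h : 𝓐.symbol c (k + N) (𝓐.DtPow F j χ) = 0 by
    rw [Derivation.leibniz, hg, h, smul_zero, smul_zero, add_zero]
  rcases le_or_gt (c + j) m with hcj | hcj
  · exact symbol_DtPow_eq_zero hN hF₀ hF hχ hc hcj c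
  · rw [symbol_DtPow_of_lt_add (i := c + j - (m + 1)) hN hF₀ hF hχ hc (by omega) (by omega)
      (by omega), if_neg (by omega)]

theorem symbol_sum_mul_DxPow (hF₀ : 𝓐.RowOrderLE 0 N F) {s : Fin (m + 1)}
    (hχ : 𝓐.RowOrderLE s k χ) {f : (Fin n → ℕ) → R}
    (hf : ∀ K, len K ≤ N → 𝓐.symbol s (k + N) (f K) = 0)
    (htop : ∀ K, len K = N → f K = (-1 : 𝕜) ^ N • 𝓐.du 0 K F) :
    𝓐.symbol s (k + N) (∑ K ∈ lenLE N, f K * 𝓐.DxPow K χ) =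
      (-1 : 𝕜) ^ N • (𝓐.symbol 0 N F * 𝓐.symbol s k χ) := by
  have hsupp : (𝓐.linearization 0 F).support ⊆ lenLE N := fun K hK =>
    mem_lenLE.2 (not_lt.1 fun hlt => Finsupp.mem_support_iff.1 hK (hF₀ K hlt))
  rw [map_sum, symbol_apply (s := 0), homogeneousPart_eq_sum hsupp, Finset.sum_mul, Finset.smul_sum]
  refine Finset.sum_congr rfl fun K hK => ?_
  rw [Derivation.leibniz, hf K (mem_lenLE.1 hK), smul_zero, add_zero]
  rcases (mem_lenLE.1 hK).lt_or_eq with hlt | rfl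
  · rw [(hχ.dxPow K).symbol_eq_zero (Nat.add_lt_add_left hlt k), smul_zero, if_neg hlt.ne, zero_mul,
      smul_zero]
  · rw [hχ.symbol_DxPow, htop K rfl, if_pos rfl, linearization_apply, smul_assoc, ← smul_mul_assoc,
      AddMonoidAlgebra.smul_single', mul_one]

theorem symbol_mul_symbol_eq_zero [Invertible (2 : 𝕜)] (hN : 0 < N) (hodd : Odd (N + (m + 1)))
    (hF₀ : 𝓐.RowOrderLE 0 N F) (hF : ∀ s ≠ 0, 𝓐.RowOrderLE s 0 F)
    (hχ : ∀ s, 𝓐.RowOrderLE s k χ) (hc : ∀ s > c, 𝓐.symbol s k χ = 0)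
    (hspace : ∀ K, len K ≤ N → 𝓐.symbol c (k + N) (𝓐.spaceCoeff F K) = 0)
    (htime : ∀ s ∈ Finset.range m, 𝓐.symbol c (k + N) (𝓐.timeCoeff F (s + 1)) = 0)
    (heq : (-1 : 𝕜) ^ (m + 1) • 𝓐.DtPow F (m + 1) χ =
      ∑ s : Fin (m + 1), (-1 : 𝕜) ^ (s : ℕ) • 𝓐.DtPow F s (𝓐.adjoint s F χ)) :
    𝓐.symbol 0 N F * 𝓐.symbol c k χ = 0 := by
  have hleft : 𝓐.symbol c (k + N) (𝓐.DtPow F (m + 1) χ) = 𝓐.symbol 0 N F * 𝓐.symbol c k χ := by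
    rw [symbol_DtPow_of_lt_add (i := c) hN hF₀ hF hχ hc (by omega) le_rfl le_rfl, if_pos rfl]
  have hsymbol : (-1 : 𝕜) ^ (m + 1) • (𝓐.symbol 0 N F * 𝓐.symbol c k χ) =
      (-1 : 𝕜) ^ N • (𝓐.symbol 0 N F * 𝓐.symbol c k χ) := by
    have hdu : ∀ s I, s ≠ 0 → I ≠ 0 → 𝓐.du s I F = 0 := fun s I hs hI =>
      hF s hs I (Nat.pos_of_ne_zero (len_eq_zero.not.2 hI))
    rw [← hleft, ← Derivation.map_smul, heq, 𝓐.sum_DtPow_adjoint hdu hF₀, map_add,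
      symbol_sum_mul_DxPow hF₀ (hχ c) hspace fun K => 𝓐.spaceCoeff_of_len_eq hN hF₀, map_sum,
      Finset.sum_eq_zero fun s hs => symbol_mul_DtPow_of_lt hN hF₀ hF hχ hc (htime s hs)
        (Finset.mem_range.1 hs), add_zero, hleft]
  have htwo : (2 : 𝕜) • (𝓐.symbol 0 N F * 𝓐.symbol c k χ) = 0 := by
    have hneg := congrArg ((-1 : 𝕜) ^ N • ·) hsymbol
    simp only [smul_smul, ← pow_add, hodd.neg_one_pow, Even.neg_one_pow ⟨N, rfl⟩, neg_smul,
      one_smul] at hneg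
    rw [two_smul]
    nth_rewrite 1 [← hneg]
    exact neg_add_cancel _
  rw [← invOf_smul_smul (2 : 𝕜) (𝓐.symbol 0 N F * 𝓐.symbol c k χ), htwo, smul_zero]

end EvolutionSymbol

end CoordAlgebra

section SmoothFunctions

variable {n h : ℕ} {U : Set (JetSpace n h)} {f f' : JetSpace n h → ℝ}

theorem isOpen_restrict_image (hU : IsOpen U) (S : Finset (JetVar n h)) :
    IsOpen (S.restrict (π := fun _ => ℝ) '' U) := by
  rw [isOpen_iff_mem_nhds]
  rintro _ ⟨p, hp, rfl⟩
  let fill : (S → ℝ) → JetSpace n h := fun q v => if hv : v ∈ S then q ⟨v, hv⟩ else p v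
  have hfill : Continuous fill := by
    refine continuous_pi fun v => ?_
    by_cases hv : v ∈ S
    · simpa only [fill, hv, dite_true] using continuous_apply _
    · simpa only [fill, hv, dite_false] using continuous_const
  have hfill_restrict : fill (S.restrict p) = p := by
    funext v
    by_cases hv : v ∈ S <;> simp [fill, hv]
  have hmem : fill ⁻¹' U ∈ nhds (S.restrict p) :=
    hfill.continuousAt.preimage_mem_nhds (by rw [hfill_restrict]; exact hU.mem_nhds hp)
  refine Filter.mem_of_superset hmem fun q hq => ⟨fill q, hq, ?_⟩
  funext v
  simp [fill]

theorem eventually_update_mem (hU : IsOpen U) (v : JetVar n h) {p : JetSpace n h} (hp : p ∈ U) :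
    ∀ᶠ c in nhds (p v), Function.update p v c ∈ U := by
  have hupdate : Continuous fun c : ℝ => Function.update p v c :=
    continuous_const.update v continuous_id
  exact hupdate.continuousAt.preimage_mem_nhds (by simpa using hU.mem_nhds hp)

theorem pd_congr (hU : IsOpen U) (hf : Set.EqOn f f' U) (v : JetVar n h) :
    Set.EqOn (pd v f) (pd v f') U := fun _ hp =>
  Filter.EventuallyEq.deriv_eq ((eventually_update_mem hU v hp).mono fun _ hc => hf hc)

/-- The direction in which the coordinates from `S` move with the coordinate `v`; it is zero if
`v ∉ S`. -/
def coordVec (S : Finset (JetVar n h)) (v : JetVar n h) : S → ℝ :=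
  fun w => if (w : JetVar n h) = v then 1 else 0

theorem coordVec_of_notMem {S : Finset (JetVar n h)} {v : JetVar n h} (hv : v ∉ S) :
    coordVec S v = 0 :=
  funext fun w => if_neg (ne_of_mem_of_not_mem w.2 hv)

theorem hasDerivAt_restrict_update (S : Finset (JetVar n h)) (v : JetVar n h) (p : JetSpace n h) :
    HasDerivAt (fun c : ℝ => S.restrict (Function.update p v c)) (coordVec S v) (p v) := by
  rw [hasDerivAt_pi]
  rintro ⟨w, hw⟩
  by_cases hwv : w = v
  · subst hwv
    simpa [coordVec] using hasDerivAt_id' (p w)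
  · simpa [coordVec, hwv] using hasDerivAt_const (p v) (p w)

theorem hasDerivAt_comp_update (hU : IsOpen U) {S : Finset (JetVar n h)} {g : (S → ℝ) → ℝ}
    (hg : ContDiffOn ℝ ∞ g (S.restrict (π := fun _ => ℝ) '' U))
    (hf : ∀ p ∈ U, f p = g (S.restrict p)) (v : JetVar n h) {p : JetSpace n h} (hp : p ∈ U) :
    HasDerivAt (fun c : ℝ => f (Function.update p v c))
      (fderiv ℝ g (S.restrict p) (coordVec S v)) (p v) := by
  have hgp : DifferentiableAt ℝ g (S.restrict p) :=
    (hg.contDiffAt ((isOpen_restrict_image hU S).mem_nhds ⟨p, hp, rfl⟩)).differentiableAt (by simp)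
  have hgp' : HasFDerivAt g (fderiv ℝ g (S.restrict p))
      (S.restrict (Function.update p v (p v))) := by
    simpa only [Function.update_eq_self] using hgp.hasFDerivAt
  exact (hgp'.comp_hasDerivAt (p v) (hasDerivAt_restrict_update S v p)).congr_of_eventuallyEq
    ((eventually_update_mem hU v hp).mono fun _ hc => hf _ hc)

theorem contDiffOn_fderiv_apply (hU : IsOpen U) {S : Finset (JetVar n h)} {g : (S → ℝ) → ℝ}
    (hg : ContDiffOn ℝ ∞ g (S.restrict (π := fun _ => ℝ) '' U)) (d : S → ℝ) :
    ContDiffOn ℝ ∞ (fun q => fderiv ℝ g q d) (S.restrict (π := fun _ => ℝ) '' U) :=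
  (hg.fderiv_of_isOpen (isOpen_restrict_image hU S) (by simp)).clm_apply contDiffOn_const

namespace SmoothOn

theorem congr (hf : SmoothOn U f) (hff : Set.EqOn f' f U) : SmoothOn U f' := by
  obtain ⟨S, g, hg, hfg⟩ := hf
  exact ⟨S, g, hg, fun p hp => (hff hp).trans (hfg p hp)⟩

theorem exists_of_subset (hf : SmoothOn U f) : ∃ S : Finset (JetVar n h), ∀ T, S ⊆ T →
    ∃ g : (T → ℝ) → ℝ, ContDiffOn ℝ ∞ g (T.restrict (π := fun _ => ℝ) '' U) ∧
      ∀ p ∈ U, f p = g (T.restrict p) := by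
  obtain ⟨S, g, hg, hfg⟩ := hf
  refine ⟨S, fun T hST => ⟨fun q => g fun v => q ⟨v, hST v.2⟩, ?_, fun p hp => hfg p hp⟩⟩
  refine hg.comp (contDiff_pi.2 fun v => contDiff_apply ℝ ℝ _).contDiffOn ?_
  rintro _ ⟨p, hp, rfl⟩
  exact ⟨p, hp, rfl⟩

theorem exists_common (hf : SmoothOn U f) (hf' : SmoothOn U f') :
    ∃ (S : Finset (JetVar n h)) (g g' : (S → ℝ) → ℝ),
      ContDiffOn ℝ ∞ g (S.restrict (π := fun _ => ℝ) '' U) ∧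
      ContDiffOn ℝ ∞ g' (S.restrict (π := fun _ => ℝ) '' U) ∧
      (∀ p ∈ U, f p = g (S.restrict p)) ∧ ∀ p ∈ U, f' p = g' (S.restrict p) := by
  obtain ⟨S, hS⟩ := hf.exists_of_subset
  obtain ⟨S', hS'⟩ := hf'.exists_of_subset
  obtain ⟨g, hg, hfg⟩ := hS (S ∪ S') Finset.subset_union_left
  obtain ⟨g', hg', hfg'⟩ := hS' (S ∪ S') Finset.subset_union_right
  exact ⟨_, g, g', hg, hg', hfg, hfg'⟩

theorem add (hf : SmoothOn U f) (hf' : SmoothOn U f') : SmoothOn U (f + f') := by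
  obtain ⟨S, g, g', hg, hg', hfg, hfg'⟩ := hf.exists_common hf'
  exact ⟨S, g + g', hg.add hg', fun p hp => congrArg₂ _ (hfg p hp) (hfg' p hp)⟩

theorem mul (hf : SmoothOn U f) (hf' : SmoothOn U f') : SmoothOn U (f * f') := by
  obtain ⟨S, g, g', hg, hg', hfg, hfg'⟩ := hf.exists_common hf'
  exact ⟨S, g * g', hg.mul hg', fun p hp => congrArg₂ _ (hfg p hp) (hfg' p hp)⟩

theorem const (c : ℝ) : SmoothOn U fun _ => c :=
  ⟨∅, fun _ => c, contDiffOn_const, fun _ _ => rfl⟩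

theorem coord (v : JetVar n h) : SmoothOn U fun p => p v :=
  ⟨{v}, fun q => q ⟨v, Finset.mem_singleton_self v⟩, (contDiff_apply ℝ ℝ _).contDiffOn,
    fun _ _ => rfl⟩

theorem continuousOn (hf : SmoothOn U f) : ContinuousOn f U := by
  obtain ⟨S, g, hg, hfg⟩ := hf
  refine (hg.continuousOn.comp ?_ (Set.mapsTo_image _ U)).congr hfg
  exact (continuous_pi fun v => continuous_apply _).continuousOn

theorem pd (hU : IsOpen U) (hf : SmoothOn U f) (v : JetVar n h) : SmoothOn U (pd v f) := by
  obtain ⟨S, g, hg, hfg⟩ := hf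
  exact ⟨S, _, contDiffOn_fderiv_apply hU hg (coordVec S v),
    fun p hp => (hasDerivAt_comp_update hU hg hfg v hp).deriv⟩

theorem differentiableAt_comp_update (hU : IsOpen U) (hf : SmoothOn U f) (v : JetVar n h)
    {p : JetSpace n h} (hp : p ∈ U) :
    DifferentiableAt ℝ (fun c : ℝ => f (Function.update p v c)) (p v) := by
  obtain ⟨S, g, hg, hfg⟩ := hf
  exact (hasDerivAt_comp_update hU hg hfg v hp).differentiableAt

theorem pd_pd_eq_fderiv_fderiv (hU : IsOpen U) {S : Finset (JetVar n h)} {g : (S → ℝ) → ℝ}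
    (hg : ContDiffOn ℝ ∞ g (S.restrict (π := fun _ => ℝ) '' U))
    (hf : ∀ p ∈ U, f p = g (S.restrict p)) (v w : JetVar n h) {p : JetSpace n h} (hp : p ∈ U) :
    GenEvolution.pd v (GenEvolution.pd w f) p = fderiv ℝ (fderiv ℝ g) (S.restrict p)
      (coordVec S v) (coordVec S w) := by
  have hdiff : DifferentiableAt ℝ (fderiv ℝ g) (S.restrict p) :=
    ((hg.contDiffAt ((isOpen_restrict_image hU S).mem_nhds ⟨p, hp, rfl⟩)).fderiv_right
      (m := 1) (by norm_cast)).differentiableAt one_ne_zero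
  refine (hasDerivAt_comp_update hU (contDiffOn_fderiv_apply hU hg (coordVec S w))
    (fun q hq => (hasDerivAt_comp_update hU hg hf w hq).deriv) v hp).deriv.trans ?_
  rw [fderiv_clm_apply hdiff (differentiableAt_const _)]
  simp

theorem pd_comm (hU : IsOpen U) (hf : SmoothOn U f) (v w : JetVar n h) :
    Set.EqOn (GenEvolution.pd v (GenEvolution.pd w f)) (GenEvolution.pd w (GenEvolution.pd v f))
      U := by
  intro p hp
  obtain ⟨S, g, hg, hfg⟩ := hf
  have hgp : ContDiffAt ℝ ∞ g (S.restrict p) :=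
    hg.contDiffAt ((isOpen_restrict_image hU S).mem_nhds ⟨p, hp, rfl⟩)
  rw [pd_pd_eq_fderiv_fderiv hU hg hfg v w hp, pd_pd_eq_fderiv_fderiv hU hg hfg w v hp]
  exact (hgp.isSymmSndFDerivAt (by simp; norm_cast)).eq _ _

theorem isOpen_inter_ne_zero (hU : IsOpen U) (hf : SmoothOn U f) :
    IsOpen (U ∩ {p | f p ≠ 0}) :=
  hf.continuousOn.isOpen_inter_preimage hU isOpen_compl_singleton

theorem finite_pd_ne_zero (hU : IsOpen U) (hf : SmoothOn U f) :
    {v | ∃ p ∈ U, GenEvolution.pd v f p ≠ 0}.Finite := by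
  obtain ⟨S, g, hg, hfg⟩ := hf
  refine S.finite_toSet.subset ?_
  rintro v ⟨p, hp, hv⟩
  by_contra hvS
  refine hv ((hasDerivAt_comp_update hU hg hfg v hp).deriv.trans ?_)
  rw [coordVec_of_notMem hvS, map_zero]

end SmoothOn

end SmoothFunctions

section SmoothAlgebra

variable {n h : ℕ} {U : Set (JetSpace n h)} {f f' : JetSpace n h → ℝ}

/-- The extension by zero of a function on `U`. It is used only to speak of smoothness and partial
derivatives on `U`, so its values elsewhere do not matter. -/
abbrev zeroExtend (r : U → ℝ) : JetSpace n h → ℝ := Function.extend Subtype.val r 0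

theorem eqOn_zeroExtend {r : U → ℝ} (hf : ∀ p : U, f p = r p) : Set.EqOn f (zeroExtend r) U :=
  fun p hp => (hf ⟨p, hp⟩).trans (Subtype.val_injective.extend_apply r 0 ⟨p, hp⟩).symm

theorem zeroExtend_apply (r : U → ℝ) (p : U) : zeroExtend r p = r p :=
  Subtype.val_injective.extend_apply r 0 p

/-- The algebra of the restrictions to `U` of smooth functions of finitely many coordinates. -/
def smoothAlg (U : Set (JetSpace n h)) : Subalgebra ℝ (U → ℝ) where
  carrier := {r | SmoothOn U (zeroExtend r)}
  mul_mem' {r r'} hr hr' := (hr.mul hr').congr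
    (eqOn_zeroExtend fun p => by simp only [Pi.mul_apply, zeroExtend_apply]).symm
  add_mem' {r r'} hr hr' := (hr.add hr').congr
    (eqOn_zeroExtend fun p => by simp only [Pi.add_apply, zeroExtend_apply]).symm
  algebraMap_mem' c := (SmoothOn.const c).congr
    (eqOn_zeroExtend (f := fun _ => c) (r := fun _ => c) fun _ => rfl).symm

theorem smoothOn_zeroExtend (r : smoothAlg U) : SmoothOn U (zeroExtend r.1) := r.2

/-- The restriction to `U` of a smooth function. -/
def SmoothOn.toAlg (hf : SmoothOn U f) : smoothAlg U :=
  ⟨fun p => f p, hf.congr (eqOn_zeroExtend fun _ => rfl).symm⟩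

/-- The evaluation of smooth functions at a point of `U`. -/
def ev (p : U) : smoothAlg U →ₐ[ℝ] ℝ := (Pi.evalAlgHom ℝ (fun _ : U => ℝ) p).comp (smoothAlg U).val

theorem smoothAlg_ext {r r' : smoothAlg U} (hr : ∀ p, ev p r = ev p r') : r = r' :=
  Subtype.ext (funext hr)

/-- The function `f` restricts to the element `r` of the algebra of smooth functions on `U`. -/
def Represents (f : JetSpace n h → ℝ) (r : smoothAlg U) : Prop := ∀ p : U, f p = ev p r

theorem represents_zeroExtend (r : smoothAlg U) : Represents (zeroExtend r.1) r :=
  zeroExtend_apply r.1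

theorem SmoothOn.represents_toAlg (hf : SmoothOn U f) : Represents f hf.toAlg := fun _ => rfl

namespace Represents

variable {r r' : smoothAlg U}

theorem add (hf : Represents f r) (hf' : Represents f' r') : Represents (f + f') (r + r') :=
  fun p => by rw [Pi.add_apply, hf p, hf' p, map_add]

theorem mul (hf : Represents f r) (hf' : Represents f' r') : Represents (f * f') (r * r') :=
  fun p => by rw [Pi.mul_apply, hf p, hf' p, map_mul]

theorem const_smul (hf : Represents f r) (c : ℝ) : Represents (c • f) (c • r) :=
  fun p => by rw [Pi.smul_apply, hf p, map_smul]

theorem pd_eq (hU : IsOpen U) (hf : Represents f r) (hf' : Represents f' r) (v : JetVar n h)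
    (p : U) : pd v f p = pd v f' p :=
  pd_congr hU (fun q hq => (hf ⟨q, hq⟩).trans (hf' ⟨q, hq⟩).symm) v p.2

end Represents

/-- The partial derivative with respect to `v` as a derivation of the algebra of smooth functions
on `U`. -/
def pdDerivation (hU : IsOpen U) (v : JetVar n h) : Derivation ℝ (smoothAlg U) (smoothAlg U) :=
  have hdiff (r : smoothAlg U) (p : U) :=
    (smoothOn_zeroExtend r).differentiableAt_comp_update hU v p.2
  have hrepr := represents_zeroExtend (U := U)
  .mk'
    { toFun := fun r => ((smoothOn_zeroExtend r).pd hU v).toAlg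
      map_add' := fun r r' => smoothAlg_ext fun p =>
        ((hrepr (r + r')).pd_eq hU ((hrepr r).add (hrepr r')) v p).trans
          (deriv_add (hdiff r p) (hdiff r' p))
      map_smul' := fun c r => smoothAlg_ext fun p =>
        ((hrepr (c • r)).pd_eq hU ((hrepr r).const_smul c) v p).trans
          (deriv_const_mul c (hdiff r p)) }
    fun r r' => smoothAlg_ext fun p => by
      refine ((hrepr (r * r')).pd_eq hU ((hrepr r).mul (hrepr r')) v p).trans
        ((deriv_mul (hdiff r p) (hdiff r' p)).trans ?_)
      rw [Function.update_eq_self, hrepr r p, hrepr r' p, add_comm, mul_comm (deriv _ _)]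
      rfl

theorem Represents.pd (hU : IsOpen U) {r : smoothAlg U} (hf : Represents f r) (v : JetVar n h) :
    Represents (pd v f) (pdDerivation hU v r) :=
  hf.pd_eq hU (represents_zeroExtend r) v

theorem Represents.pdDerivation_ne_zero_iff (hU : IsOpen U) {r : smoothAlg U}
    (hf : Represents f r) (v : JetVar n h) :
    pdDerivation hU v r ≠ 0 ↔ ∃ p ∈ U, GenEvolution.pd v f p ≠ 0 := by
  refine ⟨fun hne => ?_, ?_⟩
  · by_contra! hcon
    exact hne (smoothAlg_ext fun p => by rw [← hf.pd hU v p, hcon p p.2, map_zero])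
  · rintro ⟨p, hp, hne⟩ hzero
    exact hne (by rw [hf.pd hU v ⟨p, hp⟩, hzero, map_zero])

theorem pd_coord (v w : JetVar n h) (p : JetSpace n h) :
    pd v (fun q => q w) p = if v = w then 1 else 0 := by
  rcases eq_or_ne v w with rfl | hvw
  · simp [pd]
  · simp [pd, Function.update_of_ne hvw.symm, hvw]

/-- The coordinate algebra of the smooth functions on `U`. -/
def smoothCoordAlgebra (hU : IsOpen U) : CoordAlgebra ℝ (JetVar n h) (smoothAlg U) where
  der := pdDerivation hU
  X v := (SmoothOn.coord v).toAlg
  der_comm v w r := smoothAlg_ext fun p => by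
    have hr := represents_zeroExtend r
    rw [← (hr.pd hU w).pd hU v p, ← (hr.pd hU v).pd hU w p,
      (smoothOn_zeroExtend r).pd_comm hU v w p.2]
  der_X v w := smoothAlg_ext fun p => by
    rw [← (SmoothOn.coord w).represents_toAlg.pd hU v p, pd_coord, apply_ite (ev p), map_one,
      map_zero]
  finite_der r := ((smoothOn_zeroExtend r).finite_pd_ne_zero hU).subset fun v =>
    ((represents_zeroExtend r).pdDerivation_ne_zero_iff hU v).1

end SmoothAlgebra

section Fields

variable {R : Type*} [CommRing R] {n h : ℕ}

/-- The coordinates `u_{s,I}` as a family indexed by the pairs `(s, I)`. -/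
abbrev JetVar.uPair (w : Fin h × (Fin n → ℕ)) : JetVar n h := .u w.1 w.2

theorem JetVar.uPair_injective : Function.Injective (JetVar.uPair (n := n) (h := h)) := by
  rintro ⟨s, I⟩ ⟨s', I'⟩ hw
  injection hw with hs hI
  exact Prod.ext hs hI

theorem eq_single_add_extend_uPair {c : JetVar n h → R} {v : JetVar n h} (hv : c v = 1)
    (hvu : ∀ s I, v ≠ .u s I) (hc : ∀ w ≠ v, (∀ s I, w ≠ .u s I) → c w = 0) :
    c = Pi.single v 1 + Function.extend JetVar.uPair (fun w => c (.u w.1 w.2)) 0 := by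
  funext w
  rw [Pi.add_apply]
  by_cases hw : ∃ a, JetVar.uPair a = w
  · obtain ⟨⟨s, I⟩, rfl⟩ := hw
    rw [JetVar.uPair_injective.extend_apply, Pi.single_eq_of_ne (hvu s I).symm, zero_add]
  · rw [Function.extend_apply' _ _ _ hw, Pi.zero_apply, add_zero]
    rcases eq_or_ne w v with rfl | hwv
    · rw [hv, Pi.single_eq_same]
    · rw [Pi.single_eq_of_ne hwv, hc w hwv fun s I hu => hw ⟨(s, I), hu.symm⟩]

end Fields

namespace Represents

section Dx

variable {n h : ℕ} {U : Set (JetSpace n h)} (hU : IsOpen U) {f : JetSpace n h → ℝ}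
  {r : smoothAlg U}

include hU

theorem du (hf : Represents f r) (s : Fin h) (I : Fin n → ℕ) :
    Represents (GenEvolution.pd (.u s I) f) ((smoothCoordAlgebra hU).du s I r) :=
  hf.pd hU (.u s I)

theorem vectorField (hf : Represents f r) {v : JetVar n h}
    {a : Fin h × (Fin n → ℕ) → JetSpace n h → ℝ} {c : JetVar n h → smoothAlg U} (hv : c v = 1)
    (hvu : ∀ s I, v ≠ .u s I) (hc : ∀ w ≠ v, (∀ s I, w ≠ .u s I) → c w = 0)
    (ha : ∀ w, Represents (a w) (c (.u w.1 w.2))) :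
    Represents (fun p => GenEvolution.pd v f p + ∑ᶠ w, a w p * GenEvolution.pd (.u w.1 w.2) f p)
      ((smoothCoordAlgebra hU).field c r) := by
  intro p
  have hfin : (Function.support fun w : Fin h × (Fin n → ℕ) =>
      c (.u w.1 w.2) * (smoothCoordAlgebra hU).der (.u w.1 w.2) r).Finite :=
    (((smoothCoordAlgebra hU).finite_der r).preimage JetVar.uPair_injective.injOn).subset
      fun w hw => right_ne_zero_of_mul hw
  rw [eq_single_add_extend_uPair hv hvu hc, CoordAlgebra.field_add, CoordAlgebra.field_single,
    one_mul, CoordAlgebra.field_extend _ JetVar.uPair_injective, map_add, map_finsum (ev p) hfin]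
  refine congrArg₂ _ (hf.pd hU v p) (finsum_congr fun w => ?_)
  rw [map_mul, ← ha w p, hf.pd hU _ p]
  rfl

theorem Dx (hf : Represents f r) (i : Fin n) :
    Represents (Dx i f) ((smoothCoordAlgebra hU).Dx i r) := by
  refine hf.vectorField hU (v := .x i) (if_pos rfl) (by simp) (fun w hw hu => ?_) fun w p => rfl
  cases w with
  | t => rfl
  | x j => exact if_neg fun hj => hw (congrArg _ hj)
  | u s I => exact absurd rfl (hu s I)

theorem DxPow (hf : Represents f r) (I : Fin n → ℕ) :
    Represents (DxPow I f) ((smoothCoordAlgebra hU).DxPow I r) := by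
  rw [CoordAlgebra.DxPow, multiPow, GenEvolution.DxPow]
  induction List.finRange n with
  | nil => exact hf
  | cons i l ih =>
    rw [List.foldr_cons, List.map_cons, List.prod_cons, Module.End.mul_apply]
    induction I i with
    | zero => exact ih
    | succ j ihj =>
      rw [Function.iterate_succ_apply', pow_succ', Module.End.mul_apply]
      exact ihj.Dx hU i

end Dx

section Dt

variable {n m : ℕ} {U : Set (JetSpace n (m + 1))} (hU : IsOpen U)
  {f F : JetSpace n (m + 1) → ℝ} {r rF : smoothAlg U}

include hU

theorem timeDerivCoord (hF : Represents F rF) (s : Fin (m + 1)) (I : Fin n → ℕ) :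
    Represents (timeDerivCoord F s I) ((smoothCoordAlgebra hU).dtCoeff rF (.u s I)) := by
  intro p
  rw [CoordAlgebra.dtCoeff, GenEvolution.timeDerivCoord]
  cases s using Fin.lastCases with
  | last => rw [Fin.lastCases_last, dif_neg (by simp), hF.DxPow hU I p]
  | cast s =>
    rw [Fin.lastCases_castSucc, dif_pos (by simp)]
    rfl

theorem Dt (hF : Represents F rF) (hf : Represents f r) :
    Represents (Dt F f) ((smoothCoordAlgebra hU).Dt rF r) := by
  refine hf.vectorField hU (v := .t) rfl (by simp) (fun w hw hu => ?_) fun w =>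
    hF.timeDerivCoord hU w.1 w.2
  cases w with
  | t => exact absurd rfl hw
  | x j => rfl
  | u s I => exact absurd rfl (hu s I)

theorem DtPow (hF : Represents F rF) (hf : Represents f r) (j : ℕ) :
    Represents ((GenEvolution.Dt F)^[j] f) ((smoothCoordAlgebra hU).DtPow rF j r) := by
  induction j with
  | zero => exact hf
  | succ j ih =>
    rw [Function.iterate_succ_apply', CoordAlgebra.DtPow_succ_apply]
    exact hF.Dt hU ih

theorem timeCoeff (hF : Represents F rF) (s : ℕ) :
    Represents (timeCoeff F s) ((smoothCoordAlgebra hU).timeCoeff rF s) := by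
  intro p
  rw [GenEvolution.timeCoeff, CoordAlgebra.timeCoeff, map_sum]
  refine Finset.sum_congr rfl fun j _ => ?_
  rw [hF.DtPow hU (hF.du hU j 0) _ p, map_smul, map_nsmul, nsmul_eq_mul, smul_eq_mul, mul_assoc]

theorem finsum_linearization (s : Fin (m + 1)) {E : (Fin n → ℕ) → Module.End ℝ (smoothAlg U)}
    {b : (Fin n → ℕ) → JetSpace n (m + 1) → ℝ}
    (hb : ∀ I, Represents (b I) (E I ((smoothCoordAlgebra hU).du s I r))) :
    Represents (fun p => ∑ᶠ I, b I p)
      (((smoothCoordAlgebra hU).linearization s r).sum fun I d => E I d) := by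
  intro p
  rw [Finsupp.sum, map_sum]
  refine (finsum_eq_sum_of_support_subset _ fun I hI => ?_).trans
    (Finset.sum_congr rfl fun I _ => hb I p)
  refine Finsupp.mem_support_iff.2 fun hzero => hI ((hb I p).trans ?_)
  rw [← CoordAlgebra.linearization_apply, hzero, map_zero, map_zero]

theorem adjointCoeff (hf : Represents f r) (s : Fin (m + 1)) (K : Fin n → ℕ) :
    Represents (fun p => ∑ᶠ I : Fin n → ℕ, (-1 : ℝ) ^ len I *
        ((∏ i, (I i).choose (K i) : ℕ) : ℝ) *
          GenEvolution.DxPow (I - K) (GenEvolution.pd (.u s I) f) p)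
      ((smoothCoordAlgebra hU).adjointCoeff ((smoothCoordAlgebra hU).linearization s r) K) := by
  refine finsum_linearization hU s (E := fun I => (-1 : ℝ) ^ len I •
    multiChoose I K • (smoothCoordAlgebra hU).DxPow (I - K)) fun I p => ?_
  rw [LinearMap.smul_apply, LinearMap.smul_apply, map_smul, map_nsmul,
    ← (hf.du hU s I).DxPow hU (I - K) p, nsmul_eq_mul, smul_eq_mul, mul_assoc]
  rfl

theorem spaceCoeff (hF : Represents F rF) (K : Fin n → ℕ) :
    Represents (spaceCoeff m.succ_pos F K) ((smoothCoordAlgebra hU).spaceCoeff rF K) := by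
  intro p
  rw [CoordAlgebra.spaceCoeff, map_add, apply_ite (ev p), map_zero, ← hF.timeCoeff hU 0 p,
    ← hF.adjointCoeff hU 0 K p]
  rfl

theorem characteristic {J : Fin (n + 1) → JetSpace n (m + 1) → ℝ} (hJ : Represents (J 0) r) :
    Represents (characteristic m.succ_pos J)
      ((smoothCoordAlgebra hU).adjoint (Fin.last m) r 1) := by
  rw [CoordAlgebra.adjoint, CoordAlgebra.formalAdjoint_apply]
  simp only [mul_one]
  refine finsum_linearization hU (Fin.last m) (E := fun I => (-1 : ℝ) ^ len I •
    (smoothCoordAlgebra hU).DxPow I) fun I p => ?_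
  rw [LinearMap.smul_apply, map_smul, ← (hJ.du hU (Fin.last m) I).DxPow hU I p, smul_eq_mul]
  rfl

end Dt
end Represents

section Order

variable {n h : ℕ} {U : Set (JetSpace n h)} (hU : IsOpen U) {f : JetSpace n h → ℝ}
  {r : smoothAlg U}

namespace Represents

include hU

theorem finite_order (hf : Represents f r) :
    {k : ℤ | k = -1 ∨ ∃ (s : Fin h) (I : Fin n → ℕ), k = len I ∧
      ∃ p ∈ U, GenEvolution.pd (.u s I) f p ≠ 0}.Finite := by
  refine ((((smoothCoordAlgebra hU).finite_der r).preimage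
    JetVar.uPair_injective.injOn).image fun w => (len w.2 : ℤ)).insert (-1) |>.subset ?_
  rintro k (rfl | ⟨s, I, rfl, hne⟩)
  · exact Set.mem_insert _ _
  · exact Set.mem_insert_of_mem _ ⟨(s, I), (hf.pdDerivation_ne_zero_iff hU (.u s I)).2 hne, rfl⟩

theorem len_le_order (hf : Represents f r) {s : Fin h} {I : Fin n → ℕ}
    (hne : (smoothCoordAlgebra hU).du s I r ≠ 0) : (len I : ℤ) ≤ order U f :=
  le_csSup (hf.finite_order hU).bddAbove
    (Or.inr ⟨s, I, rfl, (hf.pdDerivation_ne_zero_iff hU (.u s I)).1 hne⟩)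

theorem symbol_eq_zero (hf : Represents f r) {k : ℕ} (hk : order U f < k) (s : Fin h) :
    (smoothCoordAlgebra hU).symbol s k r = 0 := by
  refine AddMonoidAlgebra.ext (Finsupp.ext fun I => ?_)
  rw [CoordAlgebra.coeff_symbol]
  split_ifs with hI
  · by_contra hne
    exact (hf.len_le_order hU hne).not_gt (hI ▸ hk)
  · rfl

theorem rowOrderLE (hf : Represents f r) {k : ℕ} (hk : order U f ≤ k) (s : Fin h) :
    (smoothCoordAlgebra hU).RowOrderLE s k r :=
  (smoothCoordAlgebra hU).rowOrderLE_iff_symbol.2 fun _ hl =>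
    hf.symbol_eq_zero hU (hk.trans_lt (Int.ofNat_lt.2 hl)) s

theorem exists_symbol_ne_zero (hf : Represents f r) {k : ℕ} (hk : order U f = k) :
    ∃ s, (smoothCoordAlgebra hU).symbol s k r ≠ 0 := by
  rcases Int.csSup_mem ⟨-1, Or.inl rfl⟩ (hf.finite_order hU).bddAbove with hneg | ⟨s, I, hI, hne⟩
  · exact absurd (hk.symm.trans hneg) (by omega)
  · refine ⟨s, fun hzero => (hf.pdDerivation_ne_zero_iff hU (.u s I)).2 hne ?_⟩
    have hcoeff := (smoothCoordAlgebra hU).coeff_symbol s k r I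
    rw [hzero, if_pos (Int.ofNat_inj.1 (hI.symm.trans hk))] at hcoeff
    exact hcoeff.symm

theorem exists_last_symbol_ne_zero (hf : Represents f r) {k : ℕ} (hk : order U f = k) :
    ∃ c, (smoothCoordAlgebra hU).symbol c k r ≠ 0 ∧
      ∀ s > c, (smoothCoordAlgebra hU).symbol s k r = 0 := by
  obtain ⟨c, hc⟩ := (Set.toFinite {s | (smoothCoordAlgebra hU).symbol s k r ≠ 0}).exists_maximal
    (hf.exists_symbol_ne_zero hU hk)
  exact ⟨c, hc.prop, fun s hs => not_not.1 (hc.not_prop_of_gt hs)⟩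

end Represents

end Order

section BoundO

variable {n h N : ℕ} {hh : 0 < h} {U : Set (JetSpace n h)} {F : JetSpace n h → ℝ}

theorem bddAbove_boundO (hh : 0 < h) (U : Set (JetSpace n h)) (F : JetSpace n h → ℝ) (N : ℕ) :
    BddAbove {k : ℤ | k = -1 ∨
      (∃ K : Fin n → ℕ, len K ≤ N ∧ k = order U (spaceCoeff hh F K) - N) ∨
        ∃ s : ℕ, 1 ≤ s ∧ s < h ∧ k = order U (timeCoeff F s) - N} := by
  refine ((((lenLE N).finite_toSet.image fun K => order U (spaceCoeff hh F K) - N).union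
    ((Set.finite_Iio h).image fun s => order U (timeCoeff F s) - N)).insert (-1)).subset ?_
    |>.bddAbove
  rintro k (rfl | ⟨K, hK, rfl⟩ | ⟨s, -, hs, rfl⟩)
  · exact Set.mem_insert _ _
  · exact Set.mem_insert_of_mem _ (Or.inl ⟨K, mem_lenLE.2 hK, rfl⟩)
  · exact Set.mem_insert_of_mem _ (Or.inr ⟨s, hs, rfl⟩)

theorem neg_one_le_boundO : -1 ≤ boundO hh U F N :=
  le_csSup (bddAbove_boundO hh U F N) (Or.inl rfl)

theorem order_spaceCoeff_le {K : Fin n → ℕ} (hK : len K ≤ N) :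
    order U (spaceCoeff hh F K) ≤ boundO hh U F N + N :=
  Int.le_add_of_sub_right_le
    (le_csSup (bddAbove_boundO hh U F N) (Or.inr (Or.inl ⟨K, hK, rfl⟩)))

theorem order_timeCoeff_le {s : ℕ} (hs : 1 ≤ s) (hsh : s < h) :
    order U (timeCoeff F s) ≤ boundO hh U F N + N :=
  Int.le_add_of_sub_right_le
    (le_csSup (bddAbove_boundO hh U F N) (Or.inr (Or.inr ⟨s, hs, hsh, rfl⟩)))

end BoundO

section ConservedCurrent

variable {n m N : ℕ} {U : Set (JetSpace n (m + 1))} {F : JetSpace n (m + 1) → ℝ} {rF : smoothAlg U}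

namespace Represents

variable (hU : IsOpen U) (hF : Represents F rF)

include hF

theorem rowOrderLE_zero (hdep : ∀ (s : Fin (m + 1)) (I : Fin n → ℕ), (s : ℕ) ≠ 0 → I ≠ 0 →
      ∀ p ∈ U, GenEvolution.pd (.u s I) F p = 0) {s : Fin (m + 1)} (hs : s ≠ 0) :
    (smoothCoordAlgebra hU).RowOrderLE s 0 rF := by
  intro I hI
  by_contra hne
  obtain ⟨p, hp, hne⟩ := (hF.pdDerivation_ne_zero_iff hU (.u s I)).1 hne
  exact hne (hdep s I (Fin.val_ne_zero_iff.2 hs) (fun hI₀ => hI.ne' (len_eq_zero.2 hI₀)) p hp)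

theorem eq_zero_of_symbol_mul_eq_zero (hsymb : U ⊆ closure (symbolNonzero m.succ_pos U F N))
    {q : AddMonoidAlgebra (smoothAlg U) (Fin n → ℕ)}
    (hq : (smoothCoordAlgebra hU).symbol 0 N rF * q = 0) : q = 0 := by
  by_contra hne
  obtain ⟨J, hJ⟩ : ∃ J, q.coeff J ≠ 0 := by
    by_contra! hcon
    exact hne (AddMonoidAlgebra.ext (Finsupp.ext hcon))
  obtain ⟨p₀, hp₀⟩ : ∃ p, ev p (q.coeff J) ≠ 0 := by
    by_contra! hcon
    exact hJ (smoothAlg_ext fun p => by rw [hcon p, map_zero])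
  obtain ⟨p, ⟨hp, hpJ⟩, -, I, hI, hpI⟩ := mem_closure_iff.1 (hsymb p₀.2) _
    ((smoothOn_zeroExtend (q.coeff J)).isOpen_inter_ne_zero hU)
    ⟨p₀.2, (zeroExtend_apply _ p₀).trans_ne hp₀⟩
  have hprod := congrArg (AddMonoidAlgebra.mapRingHom (Fin n → ℕ) (ev ⟨p, hp⟩).toRingHom) hq
  rw [map_mul, map_zero] at hprod
  rcases mul_eq_zero.1 hprod with hzero | hzero
  · have hcoeff := AddMonoidAlgebra.coeff_mapRingHom (ev ⟨p, hp⟩).toRingHom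
      ((smoothCoordAlgebra hU).symbol 0 N rF) I
    rw [hzero, CoordAlgebra.coeff_symbol, if_pos hI] at hcoeff
    exact hpI ((hF.du hU 0 I ⟨p, hp⟩).trans hcoeff.symm)
  · have hcoeff := AddMonoidAlgebra.coeff_mapRingHom (ev ⟨p, hp⟩).toRingHom q J
    rw [hzero] at hcoeff
    exact hpJ ((zeroExtend_apply _ ⟨p, hp⟩).trans hcoeff.symm)

end Represents

theorem IsConservedCurrent.Dt_add_sum_Dx (hU : IsOpen U) (hF : Represents F rF)
    {J : Fin (n + 1) → JetSpace n (m + 1) → ℝ} (hJ : IsConservedCurrent U F J)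
    {r : Fin (n + 1) → smoothAlg U} (hr : ∀ k, Represents (J k) (r k)) :
    (smoothCoordAlgebra hU).Dt rF (r 0) + ∑ i : Fin n, (smoothCoordAlgebra hU).Dx i (r i.succ) =
      0 := by
  refine smoothAlg_ext fun p => ?_
  rw [map_add, map_sum, map_zero, ← hJ.2 p p.2, Fin.sum_univ_succ, ← hF.Dt hU (hr 0) p]
  exact congrArg _ (Finset.sum_congr rfl fun i _ => ((hr i.succ).Dx hU i p).symm)

theorem order_characteristic_le (hN : 0 < N) (hU : IsOpen U) (hF : SmoothOn U F)
    (hdep : ∀ (s : Fin (m + 1)) (I : Fin n → ℕ), (s : ℕ) ≠ 0 → I ≠ 0 →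
      ∀ p ∈ U, pd (.u s I) F p = 0)
    (hord : order U F = (N : ℤ)) (hsymb : U ⊆ closure (symbolNonzero m.succ_pos U F N))
    (hodd : Odd (N + (m + 1))) {J : Fin (n + 1) → JetSpace n (m + 1) → ℝ}
    (hJ : IsConservedCurrent U F J) :
    order U (characteristic m.succ_pos J) ≤ boundO m.succ_pos U F N := by
  by_contra! hlt
  have hrF := hF.represents_toAlg
  have hrJ (k : Fin (n + 1)) := (hJ.1 k).represents_toAlg
  have hrχ := (hrJ 0).characteristic hU
  obtain ⟨k, hk⟩ := Int.eq_ofNat_of_zero_le (neg_one_le_boundO.trans_lt hlt)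
  obtain ⟨c, hc, hlast⟩ := hrχ.exists_last_symbol_ne_zero hU hk
  have hspace (K : Fin n → ℕ) (hK : len K ≤ N) :=
    (hrF.spaceCoeff hU K).symbol_eq_zero hU (k := k + N)
      ((order_spaceCoeff_le hK).trans_lt (by omega)) c
  have htime (s : ℕ) (hs : s ∈ Finset.range m) :=
    (hrF.timeCoeff hU (s + 1)).symbol_eq_zero hU (k := k + N)
      ((order_timeCoeff_le (N := N) (hh := m.succ_pos) s.succ_pos (by simpa using hs)).trans_lt
        (by omega)) c
  refine hc (hrF.eq_zero_of_symbol_mul_eq_zero hU hsymb ?_)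
  exact (smoothCoordAlgebra hU).symbol_mul_symbol_eq_zero hN hodd (hrF.rowOrderLE hU hord.le 0)
    (fun s hs => hrF.rowOrderLE_zero hU hdep hs) (hrχ.rowOrderLE hU hk.le) hlast hspace htime
    ((smoothCoordAlgebra hU).DtPow_adjoint_last _ (hJ.Dt_add_sum_Dx hU hrF hrJ))

end ConservedCurrent

end GenEvolution

end

theorem theorem6 (n h N : ℕ) (hh : 0 < h) (hN : 0 < N)
    (U : Set (GenEvolution.JetSpace n h)) (hU : IsOpen U)
    (F : GenEvolution.JetSpace n h → ℝ) (hF : GenEvolution.SmoothOn U F)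
    -- `F` depends on no mixed derivative `u_{s,I}` with `s ≠ 0` and `I ≠ 0`
    (hdep : ∀ (s : Fin h) (I : Fin n → ℕ), (s : ℕ) ≠ 0 → I ≠ 0 →
      ∀ p ∈ U, GenEvolution.pd (.u s I) F p = 0)
    (hord : GenEvolution.order U F = (N : ℤ))
    -- the symbol of `F` does not vanish identically on any nonempty open subset of `U`
    (hsymb : U ⊆ closure (GenEvolution.symbolNonzero hh U F N))
    (hodd : Odd (N + h)) :
    ∀ C : Set (Fin (n + 1) → GenEvolution.JetSpace n h → ℝ),
      GenEvolution.IsConservationLaw U F C →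
        ∀ k : ℤ, GenEvolution.LawHasOrder hh U C k → k ≤ GenEvolution.boundO hh U F N := by
  obtain ⟨m, rfl⟩ := Nat.exists_eq_add_one.2 hh
  rintro C ⟨J, -, rfl⟩ k ⟨J', hJ', rfl⟩
  exact GenEvolution.order_characteristic_le hN hU hF hdep hord hsymb hodd hJ'.1
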